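/- Let $k$ be a field. A $k$-category is a small category whose morphism sets are $k$-vector spaces with $k$-bilinear composition; write ${}_y\mathcal C_x$ for the space of morphisms from $x$ to $y$. A group $G$ acts freely on a $k$-category $\mathcal C$ if it acts on the objects in such a way that $sx=x$ implies $s=1$, together with linear maps ${}_y\mathcal C_x\to{}_{sy}\mathcal C_{sx}$, $c\mapsto sc$, such that $s(dc)=(sd)(sc)$, $1c=c$ and $(st)c=s(tc)$. The quotient category $\mathcal C/G$ has the $G$-orbits of objects as objects, its morphism spaces are the coinvariants $${}_v(\mathcal C/G)_u=\Bigl(\bigoplus_{x\in u,\,y\in v}{}_y\mathcal C_x\Bigr)/G,$$ and composition is induced by that of $\mathcal C$. A Galois covering $F:\mathcal C\to\mathcal B$ with group $G$ is the projection functor $\mathcal C\to\mathcal C/G=\mathcal B$ of such a free action (where $\mathcal B$ may be identified with $\mathcal C/G$ through an isomorphism of $k$-categories). A bimodule $\mathcal M$ over a $k$-category consists of vector spaces ${}_y\mathcal M_x$ with compatible associative, unital, bilinear left and right actions of the morphisms; it is locally finite if every ${}_y\mathcal M_x$ is finite dimensional. The Hochschild–Mitchell cohomology $H^*(\mathcal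 C,\mathcal M)$ is the cohomology of the complex $$C^n(\mathcal C,\mathcal M)=\prod_{(x_{n+1},\dots,x_1)}\operatorname{Hom}_k\bigl({}_{x_{n+1}}\mathcal C_{x_n}\otimes\cdots\otimes{}_{x_2}\mathcal C_{x_1},\ {}_{x_{n+1}}\mathcal M_{x_1}\bigr),\qquad C^0(\mathcal C,\mathcal M)=\prod_x{}_x\mathcal M_x,$$ with the Hochschild coboundary $$(df)(c_{n+1}\otimes\cdots\otimes c_1)=f(c_{n+1}\otimes\cdots\otimes c_2)\,c_1+\sum_{i=1}^{n}(-1)^i f(c_{n+1}\otimes\cdots\otimes c_{i+1}c_i\otimes\cdots\otimes c_1)+(-1)^{n+1}c_{n+1}\,f(c_n\otimes\cdots\otimes c_1).$$ For a $\mathcal B$-bimodule $\mathcal M$ the lifted $\mathcal C$-bimodule $L\mathcal M$ is given by ${}_y(L\mathcal M)_x={}_{Fy}\mathcal M_{Fx}$, with $\mathcal C$ acting through $F$. The group $G$ acts on $C^n(\mathcal C,L\mathcal M)$ by $(sf)(c_n\otimes\cdots\otimes c_1)=f(s^{-1}c_n\otimes\cdots\otimes s^{-1}c_1)$, which makes every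 $H^q(\mathcal C,L\mathcal M)$ a $kG$-module. **Theorem (Cartan–Leray, cohomological).** Let $F:\mathcal C\to\mathcal B$ be a Galois covering of $k$-categories with group $G$ and let $\mathcal M$ be a locally finite $\mathcal B$-bimodule. There is a first quadrant spectral sequence of cohomological type $(E_r^{p,q},\,d_r:E_r^{p,q}\to E_r^{p+r,q-r+1})_{r\ge2}$ of $k$-vector spaces with $$E_2^{p,q}\cong H^p\bigl(G,H^q(\mathcal C,L\mathcal M)\bigr),$$ where $H^p(G,X)$ denotes the group cohomology of $G$ with coefficients in a $kG$-module $X$, which converges to $H^n(\mathcal B,\mathcal M)$: each $H^n(\mathcal B,\mathcal M)$ has a decreasing filtration $H^n=\operatorname{Fil}^0\supseteq\operatorname{Fil}^1\supseteq\cdots\supseteq\operatorname{Fil}^{n+1}=0$ with $\operatorname{Fil}^p/\operatorname{Fil}^{p+1}\cong E_\infty^{p,n-p}$ for $0\le p\le n$. -/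

import Mathlib

open CategoryTheory

universe u

set_option linter.unusedSectionVars false

noncomputable section

/-- A `k`-linear action of a group `G` on a `k`-category `C`, extending an action of `G` on the set
of objects: every `s` sends a morphism `c : x ⟶ y` to `s c : s x ⟶ s y`, with `s (c d) = (s c)(s d)`,
`1 c = c` and `(s t) c = s (t c)`; the morphisms `eqToHom` express `1 x = x` and
`(s t) x = s (t x)`. -/
class LinearGroupAction (k G C : Type u) [Field k] [Group G] [SmallCategory C] [Preadditive C]
    [Linear k C] [MulAction G C] where
  hom (s : G) {x y : C} : (x ⟶ y) →ₗ[k] (s • x ⟶ s • y)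
  hom_comp (s : G) {x y z : C} (f : x ⟶ y) (g : y ⟶ z) : hom s (f ≫ g) = hom s f ≫ hom s g
  one_hom {x y : C} (f : x ⟶ y) :
    hom (1 : G) f = eqToHom (one_smul G x) ≫ f ≫ eqToHom (one_smul G y).symm
  mul_hom (s t : G) {x y : C} (f : x ⟶ y) :
    hom (s * t) f = eqToHom (mul_smul s t x) ≫ hom s (hom t f) ≫ eqToHom (mul_smul s t y).symm

/-- The action of `G` on the objects of `C` is free. -/
class FreeOnObjects (G C : Type u) [Group G] [MulAction G C] : Prop where
  eq_one_of_smul_eq : ∀ (s : G) (x : C), s • x = x → s = 1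

namespace LinearGroupAction

variable (k : Type u) {G C : Type u} [Field k] [Group G] [SmallCategory C] [Preadditive C]
  [Linear k C] [MulAction G C] [LinearGroupAction k G C]

theorem hom_eqToHom_comp (s : G) {x x' y : C} (h : x = x') (f : x' ⟶ y) :
    hom (k := k) s (eqToHom h ≫ f) = eqToHom (by rw [h]) ≫ hom (k := k) s f := by
  subst h; simp

theorem hom_comp_eqToHom (s : G) {x y y' : C} (h : y = y') (f : x ⟶ y) :
    hom (k := k) s (f ≫ eqToHom h) = hom (k := k) s f ≫ eqToHom (by rw [h]) := by
  subst h; simp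

theorem hom_inv_hom (s : G) {x y : C} (f : x ⟶ y) :
    hom (k := k) s⁻¹ (hom (k := k) s f) = eqToHom (inv_smul_smul s x) ≫ f ≫ eqToHom (inv_smul_smul s y).symm := by
  have key : ∀ (t : G) (ht : t = 1), hom (k := k) t f = eqToHom (by rw [ht, one_smul]) ≫ f ≫
      eqToHom (by rw [ht, one_smul]) := by
    intro t ht; subst ht; exact one_hom f
  have h2 := mul_hom (k := k) s⁻¹ s f
  rw [key (s⁻¹ * s) (inv_mul_cancel s)] at h2
  have h3 := congrArg (fun φ => eqToHom (mul_smul s⁻¹ s x).symm ≫ φ ≫ eqToHom (mul_smul s⁻¹ s y)) h2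
  simpa using h3.symm

theorem hom_hom_inv (s : G) {x y : C} (f : x ⟶ y) :
    hom (k := k) s (hom (k := k) s⁻¹ f) = eqToHom (smul_inv_smul s x) ≫ f ≫ eqToHom (smul_inv_smul s y).symm := by
  have key : ∀ (t : G) (ht : t = 1), hom (k := k) t f = eqToHom (by rw [ht, one_smul]) ≫ f ≫
      eqToHom (by rw [ht, one_smul]) := by
    intro t ht; subst ht; exact one_hom f
  have h2 := mul_hom (k := k) s s⁻¹ f
  rw [key (s * s⁻¹) (mul_inv_cancel s)] at h2
  have h3 := congrArg (fun φ => eqToHom (mul_smul s s⁻¹ x).symm ≫ φ ≫ eqToHom (mul_smul s s⁻¹ y)) h2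
  simpa using h3.symm

/-- The action preserves identities. -/
theorem hom_id (s : G) (x : C) : hom (k := k) s (𝟙 x) = 𝟙 (s • x) := by
  have h : ∀ g : s • x ⟶ s • x, hom (k := k) s (𝟙 x) ≫ g = g := by
    intro g
    have hg : hom (k := k) s (eqToHom (inv_smul_smul s x).symm ≫ hom (k := k) s⁻¹ g ≫
        eqToHom (inv_smul_smul s x)) = g := by
      rw [hom_eqToHom_comp, hom_comp_eqToHom, hom_hom_inv]
      simp
    rw [← hg, ← hom_comp, Category.id_comp]
  simpa using h (𝟙 _)

end LinearGroupAction

/-- The set of objects of the quotient category `C/G`: the set of `G`-orbits of objects of `C`. -/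
def OrbitCategory (k G C : Type u) [Field k] [Group G] [MulAction G C] : Type u :=
  MulAction.orbitRel.Quotient G C

namespace OrbitCategory

open LinearGroupAction

section

variable (k G : Type u) {C : Type u} [Field k] [Group G] [MulAction G C]

/-- The orbit of an object. -/
def mk (x : C) : OrbitCategory k G C := Quotient.mk (MulAction.orbitRel G C) x

theorem mk_smul (s : G) (x : C) : mk k G (s • x) = mk k G x :=
  Quotient.sound (s := MulAction.orbitRel G C) ⟨s, rfl⟩

theorem mk_eq_iff {x y : C} : mk k G x = mk k G y ↔ ∃ s : G, s • y = x :=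
  Quotient.eq (r := MulAction.orbitRel G C)

theorem exists_rep (u : OrbitCategory k G C) : ∃ x : C, mk k G x = u :=
  Quotient.exists_rep u

end

variable {k G C : Type u} [Field k] [Group G] [SmallCategory C] [Preadditive C]
  [Linear k C] [MulAction G C] [LinearGroupAction k G C]

/-- The pairs `(x, y)` of objects of `C` with `x ∈ u` and `y ∈ v`. -/
abbrev Pairs (u v : OrbitCategory k G C) : Type u :=
  {p : C × C // mk k G p.1 = u ∧ mk k G p.2 = v}

/-- The translate of a pair by an element of the group. -/
def Pairs.smul (s : G) {u v : OrbitCategory k G C} (p : Pairs u v) : Pairs u v :=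
  ⟨(s • p.1.1, s • p.1.2), (mk_smul k G s _).trans p.2.1, (mk_smul k G s _).trans p.2.2⟩

/-- The direct sum over `x ∈ u`, `y ∈ v` of the spaces of morphisms from `x` to `y`. -/
abbrev HomSum (u v : OrbitCategory k G C) : Type u :=
  DirectSum (Pairs u v) (fun p => p.1.1 ⟶ p.1.2)

/-- A morphism of `C`, as an element of the direct sum. -/
def single {u v : OrbitCategory k G C} {x y : C} (hx : mk k G x = u) (hy : mk k G y = v) :
    (x ⟶ y) →ₗ[k] HomSum u v :=
  letI := Classical.decEq (Pairs u v)
  DirectSum.lof k (Pairs u v) (fun p => p.1.1 ⟶ p.1.2) ⟨(x, y), hx, hy⟩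

theorem single_congr {u v : OrbitCategory k G C} {x y x' y' : C} (hx : mk k G x = u)
    (hy : mk k G y = v) (ex : x' = x) (ey : y = y') (c : x ⟶ y) :
    single (k := k) (G := G) (ex ▸ hx : mk k G x' = u) (ey ▸ hy : mk k G y' = v)
      (eqToHom ex ≫ c ≫ eqToHom ey) = single hx hy c := by
  subst ex; subst ey; simp

theorem homSum_ext {u v : OrbitCategory k G C} {N : Type*} [AddCommGroup N] [Module k N]
    {φ ψ : HomSum u v →ₗ[k] N}
    (h : ∀ (x y : C) (hx : mk k G x = u) (hy : mk k G y = v) (c : x ⟶ y),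
      φ (single hx hy c) = ψ (single hx hy c)) : φ = ψ := by
  let _ := Classical.decEq (Pairs u v)
  refine DirectSum.linearMap_ext k fun p => LinearMap.ext fun c => ?_
  have := h p.1.1 p.1.2 p.2.1 p.2.2 c
  rw [LinearMap.comp_apply, LinearMap.comp_apply]
  exact this

/-- A linear map out of the direct sum, given on the summands. -/
def homSumLift {u v : OrbitCategory k G C} {N : Type u} [AddCommGroup N] [Module k N]
    (φ : ∀ (x y : C) (_ : mk k G x = u) (_ : mk k G y = v), (x ⟶ y) →ₗ[k] N) :
    HomSum u v →ₗ[k] N :=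
  letI := Classical.decEq (Pairs u v)
  DirectSum.toModule k (Pairs u v) N (fun p => φ p.1.1 p.1.2 p.2.1 p.2.2)

theorem homSumLift_single {u v : OrbitCategory k G C} {N : Type u} [AddCommGroup N] [Module k N]
    (φ : ∀ (x y : C) (_ : mk k G x = u) (_ : mk k G y = v), (x ⟶ y) →ₗ[k] N)
    {x y : C} (hx : mk k G x = u) (hy : mk k G y = v) (c : x ⟶ y) :
    homSumLift φ (single hx hy c) = φ x y hx hy c := by
  let _ := Classical.decEq (Pairs u v)
  exact DirectSum.toModule_lof k
    (φ := fun p : Pairs u v => φ p.1.1 p.1.2 p.2.1 p.2.2) ⟨(x, y), hx, hy⟩ c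

/-- The `kG`-module structure on the direct sum: `s` sends a morphism `c : x ⟶ y` in the summand
`(x, y)` to the morphism `s c` in the summand `(s x, s y)`. -/
def homSumRep (u v : OrbitCategory k G C) : Representation k G (HomSum u v) where
  toFun s := homSumLift fun x y hx hy =>
    single ((mk_smul k G s x).trans hx) ((mk_smul k G s y).trans hy) ∘ₗ hom (k := k) s
  map_one' := by
    refine homSum_ext fun x y hx hy c => ?_
    rw [homSumLift_single, LinearMap.comp_apply, one_hom]
    exact single_congr hx hy _ _ c
  map_mul' s t := by
    refine homSum_ext fun x y hx hy c => ?_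
    rw [homSumLift_single, LinearMap.comp_apply, mul_hom, Module.End.mul_apply, homSumLift_single,
      LinearMap.comp_apply, homSumLift_single, LinearMap.comp_apply]
    exact single_congr _ _ _ _ _

theorem homSumRep_single (s : G) {u v : OrbitCategory k G C} {x y : C} (hx : mk k G x = u)
    (hy : mk k G y = v) (c : x ⟶ y) :
    homSumRep u v s (single hx hy c) =
      single ((mk_smul k G s x).trans hx) ((mk_smul k G s y).trans hy) (hom (k := k) s c) :=
  homSumLift_single _ hx hy c

/-- The morphisms of `C/G` from `u` to `v`: the quotient `X/G` (the coinvariants) of the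
`kG`-module `X = ⨁ (x ⟶ y)`, the sum being over `x ∈ u`, `y ∈ v`. -/
abbrev Hom (u v : OrbitCategory k G C) : Type u :=
  (homSumRep u v).Coinvariants

/-- The class in `C/G` of a morphism of `C`. -/
def cls {u v : OrbitCategory k G C} {x y : C} (hx : mk k G x = u) (hy : mk k G y = v) :
    (x ⟶ y) →ₗ[k] Hom u v :=
  Representation.Coinvariants.mk (homSumRep u v) ∘ₗ single hx hy

theorem cls_congr {u v : OrbitCategory k G C} {x y x' y' : C} (hx : mk k G x = u)
    (hy : mk k G y = v) (ex : x' = x) (ey : y = y') (c : x ⟶ y) :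
    cls (k := k) (G := G) (ex ▸ hx : mk k G x' = u) (ey ▸ hy : mk k G y' = v)
      (eqToHom ex ≫ c ≫ eqToHom ey) = cls hx hy c := by
  subst ex; subst ey; simp

theorem cls_hom (s : G) {u v : OrbitCategory k G C} {x y : C} (hx : mk k G x = u)
    (hy : mk k G y = v) (c : x ⟶ y) :
    cls ((mk_smul k G s x).trans hx) ((mk_smul k G s y).trans hy) (hom (k := k) s c) = cls hx hy c := by
  simp only [cls, LinearMap.comp_apply]
  rw [← homSumRep_single, Representation.Coinvariants.mk_self_apply]

theorem hom_ext' {u v : OrbitCategory k G C} {N : Type*} [AddCommGroup N] [Module k N]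
    {φ ψ : Hom u v →ₗ[k] N}
    (h : ∀ (x y : C) (hx : mk k G x = u) (hy : mk k G y = v) (c : x ⟶ y),
      φ (cls hx hy c) = ψ (cls hx hy c)) : φ = ψ := by
  refine Representation.Coinvariants.hom_ext (homSum_ext h)

/-- A linear map out of the space of morphisms of `C/G`, given by a `G`-invariant family. -/
def homLift {u v : OrbitCategory k G C} {N : Type u} [AddCommGroup N] [Module k N]
    (φ : ∀ (x y : C) (_ : mk k G x = u) (_ : mk k G y = v), (x ⟶ y) →ₗ[k] N)
    (h : ∀ (s : G) (x y : C) (hx : mk k G x = u) (hy : mk k G y = v) (c : x ⟶ y),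
      φ (s • x) (s • y) ((mk_smul k G s x).trans hx) ((mk_smul k G s y).trans hy) (hom (k := k) s c) =
        φ x y hx hy c) :
    Hom u v →ₗ[k] N :=
  Representation.Coinvariants.lift (homSumRep u v) (homSumLift φ) fun s =>
    homSum_ext fun x y hx hy c => by
      rw [LinearMap.comp_apply, homSumRep_single, homSumLift_single, homSumLift_single, h]

theorem homLift_cls {u v : OrbitCategory k G C} {N : Type u} [AddCommGroup N] [Module k N]
    (φ : ∀ (x y : C) (_ : mk k G x = u) (_ : mk k G y = v), (x ⟶ y) →ₗ[k] N) (h)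
    {x y : C} (hx : mk k G x = u) (hy : mk k G y = v) (c : x ⟶ y) :
    homLift φ h (cls hx hy c) = φ x y hx hy c :=
  homSumLift_single φ hx hy c

/-- Every morphism of `C/G` with source `u` is a sum of classes of morphisms with a given
source `x ∈ u`. -/
theorem hom_induction {u v : OrbitCategory k G C} (x : C) (hx : mk k G x = u)
    {P : Hom u v → Prop} (h0 : P 0) (hadd : ∀ f g, P f → P g → P (f + g))
    (hcls : ∀ (y : C) (hy : mk k G y = v) (c : x ⟶ y), P (cls hx hy c)) (f : Hom u v) : P f := by
  let _ := Classical.decEq (Pairs u v)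
  induction f using Representation.Coinvariants.induction_on with
  | h m =>
    induction m using DirectSum.induction_on with
    | zero => simpa using h0
    | add a b ha hb => rw [map_add]; exact hadd _ _ ha hb
    | of p c =>
      obtain ⟨⟨x', y⟩, hx', hy⟩ := p
      obtain ⟨s, rfl⟩ := (mk_eq_iff k G).1 (hx.trans hx'.symm)
      have := hcls (s • y) ((mk_smul k G s y).trans hy) (hom (k := k) s c)
      rw [cls_hom s hx' hy c] at this
      exact this

variable [FreeOnObjects G C]

theorem smul_left_injective {s t : G} {x : C} (h : s • x = t • x) : s = t := by
  have : (t⁻¹ * s) • x = x := by rw [mul_smul, h, inv_smul_smul]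
  have := FreeOnObjects.eq_one_of_smul_eq _ _ this
  rwa [inv_mul_eq_one, eq_comm] at this

/-- The element `s` of `G` with `s y' = y`, for `y` and `y'` in the same orbit. -/
def shift {v : OrbitCategory k G C} {y y' : C} (hy : mk k G y = v) (hy' : mk k G y' = v) : G :=
  ((mk_eq_iff k G).1 (hy.trans hy'.symm)).choose

theorem shift_smul {v : OrbitCategory k G C} {y y' : C} (hy : mk k G y = v)
    (hy' : mk k G y' = v) : shift hy hy' • y' = y :=
  ((mk_eq_iff k G).1 (hy.trans hy'.symm)).choose_spec

/-- The composite in `C/G` of the classes of `c : x ⟶ y` and `d : y' ⟶ z`, where `y` and `y'` are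
in the same orbit: it is the class of the composite of `c` and `s d`, where `s y' = y`. -/
def compCls {u v w : OrbitCategory k G C} (x y : C) (hx : mk k G x = u) (hy : mk k G y = v)
    (y' z : C) (hy' : mk k G y' = v) (hz : mk k G z = w) :
    (x ⟶ y) →ₗ[k] (y' ⟶ z) →ₗ[k] Hom u w :=
  LinearMap.mk₂ k
    (fun c d => cls hx ((mk_smul k G (shift hy hy') z).trans hz)
      (c ≫ eqToHom (shift_smul hy hy').symm ≫ hom (k := k) (shift hy hy') d))
    (by intros; simp) (by intros; simp) (by intros; simp) (by intros; simp)

theorem compCls_eq {u v w : OrbitCategory k G C} {x y : C} (hx : mk k G x = u) (hy : mk k G y = v)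
    {y' z : C} (hy' : mk k G y' = v) (hz : mk k G z = w) (c : x ⟶ y) (d : y' ⟶ z) (s : G)
    (hs : s • y' = y) :
    compCls x y hx hy y' z hy' hz c d =
      cls hx ((mk_smul k G s z).trans hz) (c ≫ eqToHom hs.symm ≫ hom (k := k) s d) := by
  obtain rfl : s = shift hy hy' := smul_left_injective (hs.trans (shift_smul hy hy').symm)
  rfl

/-- Composition in `C/G`, in diagrammatic order. -/
def comp (u v w : OrbitCategory k G C) : Hom u v →ₗ[k] Hom v w →ₗ[k] Hom u w :=
  homLift
    (fun x y hx hy => LinearMap.flip <| homLift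
      (fun y' z hy' hz => LinearMap.flip (compCls x y hx hy y' z hy' hz))
      (by
        intro s y' z hy' hz d
        refine LinearMap.ext fun c => ?_
        simp only [LinearMap.flip_apply]
        have ht : (shift hy hy' * s⁻¹) • s • y' = y := by
          rw [mul_smul, inv_smul_smul, shift_smul]
        rw [compCls_eq hx hy _ _ c _ (shift hy hy' * s⁻¹) ht,
          compCls_eq hx hy _ _ c d (shift hy hy') (shift_smul hy hy')]
        rw [mul_hom, hom_inv_hom, hom_eqToHom_comp, hom_comp_eqToHom]
        have e : shift hy hy' • z = (shift hy hy' * s⁻¹) • s • z := by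
          rw [mul_smul, inv_smul_smul]
        refine Eq.trans ?_ (cls_congr hx _ rfl e _)
        congr 1
        simp))
    (by
      intro s x y hx hy c
      refine hom_ext' fun y' z hy' hz d => ?_
      simp only [LinearMap.flip_apply, homLift_cls]
      have hs := shift_smul hy hy'
      have ht : (s * shift hy hy') • y' = s • y := by rw [mul_smul, hs]
      rw [compCls_eq _ _ hy' hz _ d (s * shift hy hy') ht, compCls_eq hx hy hy' hz c d _ hs]
      rw [← cls_hom s hx, LinearGroupAction.hom_comp, hom_eqToHom_comp, mul_hom]
      have e : s • shift hy hy' • z = (s * shift hy hy') • z := by rw [mul_smul]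
      refine Eq.trans ?_ (cls_congr _ _ rfl e _)
      congr 1
      simp)

theorem comp_cls_cls' {u v w : OrbitCategory k G C} {x y : C} (hx : mk k G x = u)
    (hy : mk k G y = v) {y' z : C} (hy' : mk k G y' = v) (hz : mk k G z = w) (c : x ⟶ y)
    (d : y' ⟶ z) : comp u v w (cls hx hy c) (cls hy' hz d) = compCls x y hx hy y' z hy' hz c d := by
  simp only [comp, homLift_cls, LinearMap.flip_apply]

theorem comp_cls_cls {u v w : OrbitCategory k G C} {x y z : C} (hx : mk k G x = u)
    (hy : mk k G y = v) (hz : mk k G z = w) (c : x ⟶ y) (d : y ⟶ z) :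
    comp u v w (cls hx hy c) (cls hy hz d) = cls hx hz (c ≫ d) := by
  rw [comp_cls_cls', compCls_eq hx hy hy hz c d 1 (one_smul G y), one_hom]
  refine Eq.trans ?_ (cls_congr hx hz rfl (one_smul G z).symm (c ≫ d))
  congr 1
  simp

/-- The identity of the orbit `u`: the class of the identity of any object of `u`. -/
def idCls (u : OrbitCategory k G C) : Hom u u :=
  cls (exists_rep k G u).choose_spec (exists_rep k G u).choose_spec (𝟙 _)

theorem idCls_eq {u : OrbitCategory k G C} {x : C} (hx : mk k G x = u) :
    idCls u = cls hx hx (𝟙 x) := by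
  have hx' := (exists_rep k G u).choose_spec
  obtain ⟨s, hs⟩ := (mk_eq_iff k G).1 (hx'.trans hx.symm)
  rw [← cls_hom s hx hx, hom_id]
  have := cls_congr (k := k) (G := G) ((mk_smul k G s x).trans hx) ((mk_smul k G s x).trans hx)
    hs.symm hs (𝟙 (s • x))
  rw [← this]
  simp [idCls]

/-- The quotient category `C/G`. -/
instance : SmallCategory (OrbitCategory k G C) where
  Hom u v := Hom u v
  id u := idCls u
  comp {u v w} f g := comp u v w f g
  id_comp {u v} f := by
    obtain ⟨x, hx⟩ := exists_rep k G u
    rw [idCls_eq hx]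
    refine hom_induction (P := fun f => comp u u v (cls hx hx (𝟙 x)) f = f) x hx ?_ ?_ ?_ f
    · exact map_zero _
    · intro f g hf hg; rw [map_add, hf, hg]
    · intro y hy c; rw [comp_cls_cls, Category.id_comp]
  comp_id {u v} f := by
    obtain ⟨x, hx⟩ := exists_rep k G u
    refine hom_induction (P := fun f => comp u v v f (idCls v) = f) x hx ?_ ?_ ?_ f
    · simp
    · intro f g hf hg; rw [map_add, LinearMap.add_apply, hf, hg]
    · intro y hy c; rw [idCls_eq hy, comp_cls_cls, Category.comp_id]
  assoc {t u v w} f g h := by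
    obtain ⟨x, hx⟩ := exists_rep k G t
    refine hom_induction (P := fun f =>
      comp t v w (comp t u v f g) h = comp t u w f (comp u v w g h))
      x hx ?_ ?_ ?_ f
    · simp
    · intro f f' hf hf'; simp only [map_add, LinearMap.add_apply, hf, hf']
    intro y hy c
    refine hom_induction (P := fun g =>
      comp t v w (comp t u v (cls hx hy c) g) h = comp t u w (cls hx hy c) (comp u v w g h))
      y hy ?_ ?_ ?_ g
    · simp
    · intro f f' hf hf'; simp only [map_add, LinearMap.add_apply, hf, hf']
    intro z hz d
    refine hom_induction (P := fun h =>
      comp t v w (comp t u v (cls hx hy c) (cls hy hz d)) h = comp t u w (cls hx hy c) (comp u v w (cls hy hz d) h))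
      z hz ?_ ?_ ?_ h
    · simp
    · intro f f' hf hf'; simp only [map_add, hf, hf']
    intro z' hz' e
    simp only [comp_cls_cls, Category.assoc]

instance : Preadditive (OrbitCategory k G C) where
  homGroup u v := inferInstanceAs (AddCommGroup (Hom u v))
  add_comp u v w f f' g := (comp u v w).map_add₂ f f' g
  comp_add u v w f g g' := (comp u v w f).map_add g g'

instance : Linear k (OrbitCategory k G C) where
  homModule u v := inferInstanceAs (Module k (Hom u v))
  smul_comp u v w r f g := (comp u v w).map_smul₂ r f g
  comp_smul u v w f r g := (comp u v w f).map_smul r g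

variable (k G C)

/-- The projection functor from `C` to `C/G`. -/
def proj : C ⥤ OrbitCategory k G C where
  obj x := mk k G x
  map c := cls rfl rfl c
  map_id x := (idCls_eq rfl).symm
  map_comp c d := (comp_cls_cls rfl rfl rfl c d).symm

end OrbitCategory

/-- A Galois covering with group `G`: a functor `F : C ⥤ B` which is the projection functor
`C ⥤ C/G` of a free action, up to an identification of `B` with `C/G` by an isomorphism of
`k`-categories (a fully faithful `k`-linear functor which is bijective on objects). -/
def IsGaloisCovering (k G : Type u) {C B : Type u} [Field k] [Group G] [SmallCategory C]
    [Preadditive C] [Linear k C] [MulAction G C] [LinearGroupAction k G C] [FreeOnObjects G C]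
    [SmallCategory B] [Preadditive B] [Linear k B] (F : C ⥤ B) : Prop :=
  ∃ E : OrbitCategory k G C ⥤ B, E.Additive ∧ E.Linear k ∧ E.Full ∧ E.Faithful ∧
    Function.Bijective E.obj ∧ OrbitCategory.proj k G C ⋙ E = F

namespace IsGaloisCovering

variable {k G C B : Type u} [Field k] [Group G] [SmallCategory C]
    [Preadditive C] [Linear k C] [MulAction G C] [LinearGroupAction k G C] [FreeOnObjects G C]
    [SmallCategory B] [Preadditive B] [Linear k B] {F : C ⥤ B}

theorem obj_smul (hF : IsGaloisCovering k G F) (s : G) (x : C) : F.obj (s • x) = F.obj x := by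
  obtain ⟨E, -, -, -, -, -, rfl⟩ := hF
  exact congrArg E.obj (OrbitCategory.mk_smul k G s x)

theorem map_hom (hF : IsGaloisCovering k G F) (s : G) {x y : C} (c : x ⟶ y) :
    F.map (LinearGroupAction.hom (k := k) s c) =
      eqToHom (hF.obj_smul s x) ≫ F.map c ≫ eqToHom (hF.obj_smul s y).symm := by
  obtain ⟨E, -, -, -, -, -, rfl⟩ := hF
  have ho : ∀ z : C, (OrbitCategory.proj k G C).obj (s • z) = (OrbitCategory.proj k G C).obj z :=
    OrbitCategory.mk_smul k G s
  have h : ∀ (u v : OrbitCategory k G C) (hx : (OrbitCategory.proj k G C).obj x = u)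
      (hy : (OrbitCategory.proj k G C).obj y = v)
      (hx' : (OrbitCategory.proj k G C).obj (s • x) = u)
      (hy' : (OrbitCategory.proj k G C).obj (s • y) = v),
      (OrbitCategory.proj k G C).map (LinearGroupAction.hom (k := k) s c) =
        eqToHom hx' ≫ (show u ⟶ v from OrbitCategory.cls hx' hy'
          (LinearGroupAction.hom (k := k) s c)) ≫ eqToHom hy'.symm := by
    rintro u v hx hy rfl rfl
    rw [eqToHom_refl, eqToHom_refl, Category.id_comp, Category.comp_id]
    rfl
  have key : (OrbitCategory.proj k G C).map (LinearGroupAction.hom (k := k) s c) =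
      eqToHom (ho x) ≫ (OrbitCategory.proj k G C).map c ≫ eqToHom (ho y).symm := by
    refine (h _ _ rfl rfl (ho x) (ho y)).trans ?_
    congr 2
    exact OrbitCategory.cls_hom s rfl rfl c
  rw [Functor.comp_map, key, E.map_comp, E.map_comp, eqToHom_map, eqToHom_map]
  rfl

end IsGaloisCovering

/-- A bimodule over the `k`-category `C`: the space `obj y x` is acted on the left by the
morphisms with source `y` and on the right by the morphisms with target `x`. -/
structure CatBimodule (k C : Type u) [Field k] [SmallCategory C] [Preadditive C] [Linear k C] where
  obj : C → C → Type u
  [addCommGroup : ∀ y x, AddCommGroup (obj y x)]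
  [module : ∀ y x, Module k (obj y x)]
  left {x y z : C} : (y ⟶ z) →ₗ[k] obj y x →ₗ[k] obj z x
  right {y x u : C} : (u ⟶ x) →ₗ[k] obj y x →ₗ[k] obj y u
  left_comp {x y z w : C} (c : y ⟶ z) (d : z ⟶ w) (m : obj y x) :
    left (c ≫ d) m = left d (left c m)
  right_comp {y x u v : C} (c : v ⟶ u) (d : u ⟶ x) (m : obj y x) :
    right (c ≫ d) m = right c (right d m)
  left_right {y z x u : C} (d : y ⟶ z) (c : u ⟶ x) (m : obj y x) :
    left d (right c m) = right c (left d m)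
  left_id {y x : C} (m : obj y x) : left (𝟙 y) m = m
  right_id {y x : C} (m : obj y x) : right (𝟙 x) m = m

attribute [instance] CatBimodule.addCommGroup CatBimodule.module

namespace CatBimodule

variable {k C : Type u} [Field k] [SmallCategory C] [Preadditive C] [Linear k C]

/-- A bimodule is locally finite if all its spaces are finite dimensional. -/
def LocallyFinite (M : CatBimodule k C) : Prop :=
  ∀ y x : C, FiniteDimensional k (M.obj y x)

/-- The identification of `obj y x` with `obj y' x'` for equal objects `y = y'`, `x = x'`. -/
def cast (M : CatBimodule k C) {y y' x x' : C} (hy : y = y') (hx : x = x') :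
    M.obj y x →ₗ[k] M.obj y' x' :=
  M.left (eqToHom hy) ∘ₗ M.right (eqToHom hx.symm)

@[simp]
theorem cast_rfl (M : CatBimodule k C) {y x : C} (m : M.obj y x) :
    M.cast rfl rfl m = m := by
  simp [cast, M.left_id, M.right_id]

theorem cast_cast (M : CatBimodule k C) {y y' y'' x x' x'' : C} (hy : y = y') (hx : x = x')
    (hy' : y' = y'') (hx' : x' = x'') (m : M.obj y x) :
    M.cast hy' hx' (M.cast hy hx m) = M.cast (hy.trans hy') (hx.trans hx') m := by
  subst hy hx hy' hx'; simp

theorem cast_left (M : CatBimodule k C) {y y' z z' x x' : C} (hy : y = y') (hz : z = z')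
    (hx : x = x') (c : y ⟶ z) (m : M.obj y x) :
    M.cast hz hx (M.left c m) =
      M.left (eqToHom hy.symm ≫ c ≫ eqToHom hz) (M.cast hy hx m) := by
  subst hy hz hx; simp

theorem cast_right (M : CatBimodule k C) {y y' u u' x x' : C} (hy : y = y') (hu : u = u')
    (hx : x = x') (c : u ⟶ x) (m : M.obj y x) :
    M.cast hy hu (M.right c m) =
      M.right (eqToHom hu.symm ≫ c ≫ eqToHom hx) (M.cast hy hx m) := by
  subst hy hu hx; simp

/-- The lifting `LM` of a bimodule `M` along a functor. -/
def lift {B : Type u} [SmallCategory B] [Preadditive B] [Linear k B] (F : C ⥤ B) [F.Additive]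
    [F.Linear k] (M : CatBimodule k B) : CatBimodule k C where
  obj y x := M.obj (F.obj y) (F.obj x)
  left := M.left ∘ₗ F.mapLinearMap k
  right := M.right ∘ₗ F.mapLinearMap k
  left_comp c d m := by simp [M.left_comp]
  right_comp c d m := by simp [M.right_comp]
  left_right d c m := M.left_right _ _ _
  left_id m := by simp [M.left_id]
  right_id m := by simp [M.right_id]

/-- The identification of `LM y x` with `LM y' x'` if `F y = F y'` and `F x = F x'`: both are
`M (F y) (F x)`. -/
def liftCast {B : Type u} [SmallCategory B] [Preadditive B] [Linear k B] (F : C ⥤ B)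
    [F.Additive] [F.Linear k] (M : CatBimodule k B) {y y' x x' : C} (hy : F.obj y = F.obj y')
    (hx : F.obj x = F.obj x') : (M.lift F).obj y x →ₗ[k] (M.lift F).obj y' x' :=
  M.cast hy hx

theorem liftCast_liftCast {B : Type u} [SmallCategory B] [Preadditive B] [Linear k B] (F : C ⥤ B)
    [F.Additive] [F.Linear k] (M : CatBimodule k B) {y y' y'' x x' x'' : C}
    (hy : F.obj y = F.obj y') (hx : F.obj x = F.obj x') (hy' : F.obj y' = F.obj y'')
    (hx' : F.obj x' = F.obj x'') (m : (M.lift F).obj y x) :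
    M.liftCast F hy' hx' (M.liftCast F hy hx m) =
      M.liftCast F (hy.trans hy') (hx.trans hx') m :=
  M.cast_cast hy hx hy' hx' m

theorem liftCast_eq_cast {B : Type u} [SmallCategory B] [Preadditive B] [Linear k B] (F : C ⥤ B)
    [F.Additive] [F.Linear k] (M : CatBimodule k B) {y y' x x' : C} (hy : y = y') (hx : x = x')
    (m : (M.lift F).obj y x) :
    M.liftCast F (congrArg F.obj hy) (congrArg F.obj hx) m = (M.lift F).cast hy hx m := by
  subst hy hx
  exact (M.cast_rfl m).trans ((M.lift F).cast_rfl m).symm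

theorem liftCast_left {B : Type u} [SmallCategory B] [Preadditive B] [Linear k B] (F : C ⥤ B)
    [F.Additive] [F.Linear k] (M : CatBimodule k B) {y y' z z' x x' : C} (hy : F.obj y = F.obj y')
    (hz : F.obj z = F.obj z') (hx : F.obj x = F.obj x') (c : y ⟶ z) (c' : y' ⟶ z')
    (hc : F.map c = eqToHom hy ≫ F.map c' ≫ eqToHom hz.symm) (m : (M.lift F).obj y x) :
    M.liftCast F hz hx ((M.lift F).left c m) = (M.lift F).left c' (M.liftCast F hy hx m) := by
  refine (M.cast_left hy hz hx (F.map c) m).trans ?_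
  rw [hc]
  simp
  rfl

theorem liftCast_right {B : Type u} [SmallCategory B] [Preadditive B] [Linear k B] (F : C ⥤ B)
    [F.Additive] [F.Linear k] (M : CatBimodule k B) {y y' w w' x x' : C} (hy : F.obj y = F.obj y')
    (hw : F.obj w = F.obj w') (hx : F.obj x = F.obj x') (c : w ⟶ x) (c' : w' ⟶ x')
    (hc : F.map c = eqToHom hw ≫ F.map c' ≫ eqToHom hx.symm) (m : (M.lift F).obj y x) :
    M.liftCast F hy hw ((M.lift F).right c m) = (M.lift F).right c' (M.liftCast F hy hx m) := by
  refine (M.cast_right hy hw hx (F.map c) m).trans ?_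
  rw [hc]
  simp
  rfl

end CatBimodule

namespace HochschildMitchell

section Chains

variable {C : Type u} [SmallCategory C]

/-- For composable morphisms `c j : x j ⟶ x (j + 1)`, `0 ≤ j < n`, the composite
`x p ⟶ x q` of those with `p ≤ j < q` (the identity if `p = q`). -/
def seg {n : ℕ} (x : Fin (n + 1) → C) (c : ∀ j : Fin n, x j.castSucc ⟶ x j.succ)
    {p q : Fin (n + 1)} (h : p ≤ q) : x p ⟶ x q :=
  (ComposableArrows.mkOfObjOfMapSucc x c).map (homOfLE h)

theorem seg_refl {n : ℕ} (x : Fin (n + 1) → C) (c : ∀ j : Fin n, x j.castSucc ⟶ x j.succ)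
    (p : Fin (n + 1)) : seg x c (le_refl p) = 𝟙 (x p) :=
  (ComposableArrows.mkOfObjOfMapSucc x c).map_id p

theorem seg_trans {n : ℕ} (x : Fin (n + 1) → C) (c : ∀ j : Fin n, x j.castSucc ⟶ x j.succ)
    {p q r : Fin (n + 1)} (h : p ≤ q) (h' : q ≤ r) :
    seg x c (h.trans h') = seg x c h ≫ seg x c h' :=
  (ComposableArrows.mkOfObjOfMapSucc x c).map_comp (homOfLE h) (homOfLE h')

theorem seg_succ {n : ℕ} (x : Fin (n + 1) → C) (c : ∀ j : Fin n, x j.castSucc ⟶ x j.succ)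
    (j : Fin n) : seg x c (Fin.castSucc_lt_succ (i := j)).le = c j :=
  ComposableArrows.mkOfObjOfMapSucc_map_succ x c j.1 j.2

theorem seg_induction {n : ℕ} {P : ∀ p q : Fin (n + 1), p ≤ q → Prop}
    (hrefl : ∀ p, P p p le_rfl)
    (hsucc : ∀ (p : Fin (n + 1)) (j : Fin n) (h : p ≤ j.castSucc), P p j.castSucc h →
      P p j.succ (h.trans (Fin.castSucc_lt_succ (i := j)).le))
    {p q : Fin (n + 1)} (h : p ≤ q) : P p q h := by
  revert h
  induction q using Fin.induction with
  | zero =>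
    intro h
    obtain rfl : p = 0 := Fin.le_zero_iff.1 h
    exact hrefl 0
  | succ j ih =>
    intro h
    rcases h.eq_or_lt with rfl | h'
    · exact hrefl _
    · exact hsucc p j (Fin.le_castSucc_iff.2 h') (ih _)

theorem seg_congr {n : ℕ} (x : Fin (n + 1) → C) (c c' : ∀ j : Fin n, x j.castSucc ⟶ x j.succ)
    {p q : Fin (n + 1)} (h : p ≤ q)
    (hc : ∀ j : Fin n, p ≤ j.castSucc → j.succ ≤ q → c j = c' j) :
    seg x c h = seg x c' h := by
  revert hc
  refine seg_induction (P := fun p q h => (∀ j : Fin n, p ≤ j.castSucc → j.succ ≤ q →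
    c j = c' j) → seg x c h = seg x c' h) ?_ ?_ h
  · intro p _
    rw [seg_refl, seg_refl]
  · intro p j h ih hc
    rw [seg_trans x c h (Fin.castSucc_lt_succ (i := j)).le,
      seg_trans x c' h (Fin.castSucc_lt_succ (i := j)).le, seg_succ, seg_succ, hc j h le_rfl,
      ih fun i hi hi' => hc i hi (hi'.trans (Fin.castSucc_lt_succ (i := j)).le)]

theorem seg_update_of_notMem {n : ℕ} (x : Fin (n + 1) → C)
    (c : ∀ j : Fin n, x j.castSucc ⟶ x j.succ) (i : Fin n) (a : x i.castSucc ⟶ x i.succ)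
    {p q : Fin (n + 1)} (h : p ≤ q) (hi : q ≤ i.castSucc ∨ i.succ ≤ p) :
    seg x (Function.update c i a) h = seg x c h := by
  refine seg_congr x _ _ h fun j hj hj' => ?_
  refine Function.update_of_ne ?_ _ _
  rintro rfl
  rcases hi with hi | hi
  · exact absurd (hj'.trans hi) (not_le.2 Fin.castSucc_lt_succ)
  · exact absurd (hi.trans hj) (not_le.2 Fin.castSucc_lt_succ)

theorem seg_update {n : ℕ} (x : Fin (n + 1) → C)
    (c : ∀ j : Fin n, x j.castSucc ⟶ x j.succ) (i : Fin n) (a : x i.castSucc ⟶ x i.succ)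
    {p q : Fin (n + 1)} (hp : p ≤ i.castSucc) (hq : i.succ ≤ q) :
    seg x (Function.update c i a) ((hp.trans Fin.castSucc_lt_succ.le).trans hq) =
      seg x c hp ≫ a ≫ seg x c hq := by
  rw [seg_trans x _ (hp.trans Fin.castSucc_lt_succ.le) hq,
    seg_trans x _ hp (Fin.castSucc_lt_succ (i := i)).le, seg_succ,
    seg_update_of_notMem x c i a hp (Or.inl le_rfl),
    seg_update_of_notMem x c i a hq (Or.inr le_rfl), Function.update_self, Category.assoc]

/-- The composable morphisms obtained by composing along a monotone map. -/
def pull {m n : ℕ} (θ : Fin (m + 1) →o Fin (n + 1)) (x : Fin (n + 1) → C)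
    (c : ∀ j : Fin n, x j.castSucc ⟶ x j.succ) (j : Fin m) :
    x (θ j.castSucc) ⟶ x (θ j.succ) :=
  seg x c (θ.monotone (Fin.castSucc_lt_succ (i := j)).le)

theorem seg_pull {m n : ℕ} (θ : Fin (m + 1) →o Fin (n + 1)) (x : Fin (n + 1) → C)
    (c : ∀ j : Fin n, x j.castSucc ⟶ x j.succ) {p q : Fin (m + 1)} (h : p ≤ q) :
    seg (fun i => x (θ i)) (pull θ x c) h = seg x c (θ.monotone h) := by
  refine seg_induction (P := fun p q h => seg (fun i => x (θ i)) (pull θ x c) h =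
    seg x c (θ.monotone h)) ?_ ?_ h
  · intro p
    rw [seg_refl, seg_refl]
  · intro p j h ih
    rw [seg_trans _ _ h (Fin.castSucc_lt_succ (i := j)).le, seg_succ, ih,
      seg_trans x c (θ.monotone h) (θ.monotone (Fin.castSucc_lt_succ (i := j)).le)]
    rfl

theorem pull_update {m n : ℕ} (θ : Fin (m + 1) →o Fin (n + 1)) (x : Fin (n + 1) → C)
    (c : ∀ j : Fin n, x j.castSucc ⟶ x j.succ) (i : Fin n) (a : x i.castSucc ⟶ x i.succ)
    (j : Fin m) (h : θ j.castSucc ≤ i.castSucc) (h' : i.succ ≤ θ j.succ) :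
    pull θ x (Function.update c i a) =
      Function.update (pull θ x c) j (seg x c h ≫ a ≫ seg x c h') := by
  funext l
  rcases lt_trichotomy l j with hl | rfl | hl
  · rw [Function.update_of_ne hl.ne]
    refine seg_update_of_notMem x c i a _ (Or.inl (le_trans (θ.monotone ?_) h))
    exact Fin.succ_le_castSucc_iff.2 hl
  · rw [Function.update_self]
    exact seg_update x c i a h h'
  · rw [Function.update_of_ne hl.ne']
    refine seg_update_of_notMem x c i a _ (Or.inr (le_trans h' (θ.monotone ?_)))
    exact Fin.succ_le_castSucc_iff.2 hl

theorem pull_update_of_notMem {m n : ℕ} (θ : Fin (m + 1) →o Fin (n + 1)) (x : Fin (n + 1) → C)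
    (c : ∀ j : Fin n, x j.castSucc ⟶ x j.succ) (i : Fin n) (a : x i.castSucc ⟶ x i.succ)
    (h : θ (Fin.last m) ≤ i.castSucc ∨ i.succ ≤ θ 0) :
    pull θ x (Function.update c i a) = pull θ x c := by
  funext l
  refine seg_update_of_notMem x c i a _ ?_
  rcases h with h | h
  · exact Or.inl ((θ.monotone (Fin.le_last _)).trans h)
  · exact Or.inr (h.trans (θ.monotone (Fin.zero_le _)))

theorem exists_mem {m n : ℕ} (θ : Fin (m + 1) →o Fin (n + 1)) (i : Fin n)
    (h0 : θ 0 ≤ i.castSucc) (h1 : i.succ ≤ θ (Fin.last m)) :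
    ∃ j : Fin m, θ j.castSucc ≤ i.castSucc ∧ i.succ ≤ θ j.succ := by
  by_contra! hcon
  have key : ∀ j : Fin (m + 1), θ j ≤ i.castSucc := by
    intro j
    induction j using Fin.induction with
    | zero => exact h0
    | succ j ih => exact Fin.le_castSucc_iff.2 (hcon j ih)
  exact absurd (h1.trans (key _)) (not_le.2 Fin.castSucc_lt_succ)

end Chains

variable {k C : Type u} [Field k] [SmallCategory C] [Preadditive C] [Linear k C]

/-- The Hochschild-Mitchell cochains of degree `n`: the product, over the sequences
`x 0, …, x n` of objects, of the spaces of `k`-multilinear maps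
`(x (n-1) ⟶ x n) × ⋯ × (x 0 ⟶ x 1) → M (x n) (x 0)`, that is, of linear maps from the tensor
product of the morphism spaces (which is `k` if `n = 0`). -/
abbrev Cochain (M : CatBimodule k C) (n : ℕ) : Type u :=
  ∀ x : Fin (n + 1) → C,
    MultilinearMap k (fun j : Fin n => (x j.castSucc ⟶ x j.succ)) (M.obj (x (Fin.last n)) (x 0))

/-- For a monotone map `θ : {0, …, m} → {0, …, n}` and an `m`-cochain `f`, the component at
`x 0, …, x n` of the `n`-cochain `θ f`; its value at `(c j)` is `b (f (c')) a`, where `a` is the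
composite `x 0 ⟶ x (θ 0)`, `b` is the composite `x (θ m) ⟶ x n` and `c' j` is the composite
`x (θ j) ⟶ x (θ (j + 1))`. -/
def cofaceComponent (M : CatBimodule k C) {m n : ℕ} (θ : Fin (m + 1) →o Fin (n + 1))
    (x : Fin (n + 1) → C)
    (f : MultilinearMap k (fun j : Fin m => (x (θ j.castSucc) ⟶ x (θ j.succ)))
      (M.obj (x (θ (Fin.last m))) (x (θ 0)))) :
    MultilinearMap k (fun j : Fin n => (x j.castSucc ⟶ x j.succ))
      (M.obj (x (Fin.last n)) (x 0)) where
  toFun c := M.left (seg x c (Fin.le_last _)) (M.right (seg x c (Fin.zero_le _)) (f (pull θ x c)))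
  map_update_add' {inst} c i a b := by
    obtain rfl : inst = instDecidableEqFin n := Subsingleton.elim _ _
    by_cases h0 : i.succ ≤ θ 0
    · have h1 : i.succ ≤ θ (Fin.last m) := h0.trans (θ.monotone (Fin.zero_le _))
      simp only [pull_update_of_notMem θ x c i _ (Or.inr h0),
        seg_update_of_notMem x c i _ (Fin.le_last (θ (Fin.last m))) (Or.inr h1),
        seg_update x c i _ (Fin.zero_le _) h0]
      simp
    by_cases h1 : θ (Fin.last m) ≤ i.castSucc
    · have h2 : θ 0 ≤ i.castSucc := (θ.monotone (Fin.zero_le _)).trans h1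
      simp only [pull_update_of_notMem θ x c i _ (Or.inl h1),
        seg_update_of_notMem x c i _ (Fin.zero_le (θ 0)) (Or.inl h2),
        seg_update x c i _ h1 (Fin.le_last _)]
      simp
    have h0' : θ 0 ≤ i.castSucc := Fin.le_castSucc_iff.2 (not_le.1 h0)
    have h1' : i.succ ≤ θ (Fin.last m) := Fin.castSucc_lt_iff_succ_le.1 (not_le.1 h1)
    obtain ⟨j, hj, hj'⟩ := exists_mem θ i h0' h1'
    simp only [pull_update θ x c i _ j hj hj',
        seg_update_of_notMem x c i _ (Fin.zero_le (θ 0)) (Or.inl h0'),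
        seg_update_of_notMem x c i _ (Fin.le_last (θ (Fin.last m))) (Or.inr h1')]
    simp
  map_update_smul' {inst} c i r a := by
    obtain rfl : inst = instDecidableEqFin n := Subsingleton.elim _ _
    by_cases h0 : i.succ ≤ θ 0
    · have h1 : i.succ ≤ θ (Fin.last m) := h0.trans (θ.monotone (Fin.zero_le _))
      simp only [pull_update_of_notMem θ x c i _ (Or.inr h0),
        seg_update_of_notMem x c i _ (Fin.le_last (θ (Fin.last m))) (Or.inr h1),
        seg_update x c i _ (Fin.zero_le _) h0]
      simp
    by_cases h1 : θ (Fin.last m) ≤ i.castSucc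
    · have h2 : θ 0 ≤ i.castSucc := (θ.monotone (Fin.zero_le _)).trans h1
      simp only [pull_update_of_notMem θ x c i _ (Or.inl h1),
        seg_update_of_notMem x c i _ (Fin.zero_le (θ 0)) (Or.inl h2),
        seg_update x c i _ h1 (Fin.le_last _)]
      simp
    have h0' : θ 0 ≤ i.castSucc := Fin.le_castSucc_iff.2 (not_le.1 h0)
    have h1' : i.succ ≤ θ (Fin.last m) := Fin.castSucc_lt_iff_succ_le.1 (not_le.1 h1)
    obtain ⟨j, hj, hj'⟩ := exists_mem θ i h0' h1'
    simp only [pull_update θ x c i _ j hj hj',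
        seg_update_of_notMem x c i _ (Fin.zero_le (θ 0)) (Or.inl h0'),
        seg_update_of_notMem x c i _ (Fin.le_last (θ (Fin.last m))) (Or.inr h1')]
    simp

/-- The map `f ↦ θ f` on Hochschild-Mitchell cochains. -/
def coface (M : CatBimodule k C) {m n : ℕ} (θ : Fin (m + 1) →o Fin (n + 1)) :
    Cochain M m →ₗ[k] Cochain M n where
  toFun f x := cofaceComponent M θ x (f fun i => x (θ i))
  map_add' f g := by
    funext x; ext c
    simp [cofaceComponent]
  map_smul' r f := by
    funext x; ext c
    simp [cofaceComponent]

theorem coface_apply (M : CatBimodule k C) {m n : ℕ} (θ : Fin (m + 1) →o Fin (n + 1))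
    (f : Cochain M m) (x : Fin (n + 1) → C) (c : ∀ j : Fin n, x j.castSucc ⟶ x j.succ) :
    coface M θ f x c = M.left (seg x c (Fin.le_last (θ (Fin.last m))))
      (M.right (seg x c (Fin.zero_le (θ 0))) (f (fun i => x (θ i)) (pull θ x c))) := rfl

theorem pull_pull {l m n : ℕ} (θ : Fin (l + 1) →o Fin (m + 1)) (η : Fin (m + 1) →o Fin (n + 1))
    (x : Fin (n + 1) → C) (c : ∀ j : Fin n, x j.castSucc ⟶ x j.succ) :
    pull θ (fun i => x (η i)) (pull η x c) = pull (η.comp θ) x c := by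
  funext j
  exact seg_pull η x c _

theorem coface_id (M : CatBimodule k C) (n : ℕ) :
    coface M (OrderHom.id : Fin (n + 1) →o Fin (n + 1)) = LinearMap.id := by
  refine LinearMap.ext fun f => funext fun x => MultilinearMap.ext fun c => ?_
  have h : pull OrderHom.id x c = c := by
    funext j; exact seg_succ x c j
  have hl : seg x c (Fin.le_last ((OrderHom.id : Fin (n + 1) →o Fin (n + 1)) (Fin.last n))) =
    𝟙 _ := seg_refl x c _
  have hr : seg x c (Fin.zero_le ((OrderHom.id : Fin (n + 1) →o Fin (n + 1)) 0)) =
    𝟙 _ := seg_refl x c _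
  rw [coface_apply, h, hl, hr]
  exact (M.left_id _).trans (M.right_id _)

theorem coface_comp (M : CatBimodule k C) {l m n : ℕ} (θ : Fin (l + 1) →o Fin (m + 1))
    (η : Fin (m + 1) →o Fin (n + 1)) :
    coface M (η.comp θ) = coface M η ∘ₗ coface M θ := by
  refine LinearMap.ext fun f => funext fun x => MultilinearMap.ext fun c => ?_
  rw [LinearMap.comp_apply, coface_apply, coface_apply, coface_apply, seg_pull, seg_pull,
    pull_pull, ← M.left_right, ← M.left_comp, ← M.right_comp, ← seg_trans, ← seg_trans]
  rfl

/-- The Hochschild-Mitchell cochains as a cosimplicial vector space. -/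
def cosimplicial (M : CatBimodule k C) : CosimplicialObject (ModuleCat.{u} k) where
  obj n := ModuleCat.of k (Cochain M n.len)
  map θ := ModuleCat.ofHom (coface M θ.toOrderHom)
  map_id n := ModuleCat.hom_ext (coface_id M n.len)
  map_comp θ η := ModuleCat.hom_ext (coface_comp M θ.toOrderHom η.toOrderHom)

/-- The Hochschild-Mitchell cochain complex. Its differential
`d = ∑ i ∈ {0, …, n + 1}, (-1) ^ i • δ i` sends an `n`-cochain `f` to the `(n + 1)`-cochain with
value at `c 0, …, c n`, where `c j : x j ⟶ x (j + 1)` and products are written as composites of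
functions,
`f (c n, …, c 1) (c 0) + ∑ i ∈ {1, …, n}, (-1) ^ i f (c n, …, (c i) (c (i - 1)), …, c 0)
  + (-1) ^ (n + 1) (c n) f (c (n - 1), …, c 0)`. -/
def cochainComplex (M : CatBimodule k C) : CochainComplex (ModuleCat.{u} k) ℕ :=
  (AlgebraicTopology.alternatingCofaceMapComplex (ModuleCat.{u} k)).obj (cosimplicial M)

theorem cochainComplex_d (M : CatBimodule k C) (n : ℕ) :
    (cochainComplex M).d n (n + 1) =
      ModuleCat.ofHom (∑ i : Fin (n + 2), (-1 : ℤ) ^ (i : ℕ) •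
        coface M (SimplexCategory.δ i).toOrderHom) := by
  have h : (cochainComplex M).d n (n + 1) =
      ∑ i : Fin (n + 2), (-1 : ℤ) ^ (i : ℕ) •
        ModuleCat.ofHom (coface M (SimplexCategory.δ i).toOrderHom) := by
    simp only [cochainComplex, AlgebraicTopology.alternatingCofaceMapComplex,
      AlgebraicTopology.AlternatingCofaceMapComplex.obj]
    exact CochainComplex.of_d ..
  rw [h]
  refine ModuleCat.hom_ext ?_
  refine (ModuleCat.hom_sum _ _).trans ?_
  rfl

/-- The Hochschild-Mitchell cohomology `Hⁿ(C, M)`. -/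
def cohomology (M : CatBimodule k C) (n : ℕ) : ModuleCat.{u} k :=
  (cochainComplex M).homology n

section GaloisAction

open LinearGroupAction

variable {G B : Type u} [Group G] [MulAction G C] [LinearGroupAction k G C] [FreeOnObjects G C]
  [SmallCategory B] [Preadditive B] [Linear k B] {F : C ⥤ B} [F.Additive] [F.Linear k]

theorem seg_hom (s : G) {n : ℕ} (x : Fin (n + 1) → C)
    (c : ∀ j : Fin n, x j.castSucc ⟶ x j.succ) {p q : Fin (n + 1)} (h : p ≤ q) :
    seg (fun i => s • x i) (fun j => hom (k := k) s (c j)) h = hom (k := k) s (seg x c h) := by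
  refine seg_induction (P := fun p q h => seg (fun i => s • x i)
    (fun j => hom (k := k) s (c j)) h = hom (k := k) s (seg x c h)) ?_ ?_ h
  · intro p
    rw [seg_refl, seg_refl, hom_id]
  · intro p j h ih
    rw [seg_trans _ _ h (Fin.castSucc_lt_succ (i := j)).le, seg_succ, ih,
      seg_trans x c h (Fin.castSucc_lt_succ (i := j)).le, LinearGroupAction.hom_comp, seg_succ]

/-- The action of `s ∈ G` on the cochains of `C` with values in a lifted bimodule `LM`:
`(s f) (c) = f (s⁻¹ c)`, where `LM (s⁻¹ y) (s⁻¹ x)` is identified with `LM y x`, both being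
`M (F y) (F x)`. -/
def galoisCochain (hF : IsGaloisCovering k G F) (M : CatBimodule k B) (s : G) (n : ℕ) :
    Cochain (M.lift F) n →ₗ[k] Cochain (M.lift F) n where
  toFun f x := (M.liftCast F (hF.obj_smul s⁻¹ (x (Fin.last n)))
    (hF.obj_smul s⁻¹ (x 0))).compMultilinearMap
      ((f fun i => s⁻¹ • x i).compLinearMap fun _ => hom (k := k) s⁻¹)
  map_add' f g := by
    funext x; ext c
    exact map_add (M.liftCast F (hF.obj_smul s⁻¹ (x (Fin.last n))) (hF.obj_smul s⁻¹ (x 0))) _ _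
  map_smul' r f := by
    funext x; ext c
    exact map_smul (M.liftCast F (hF.obj_smul s⁻¹ (x (Fin.last n))) (hF.obj_smul s⁻¹ (x 0))) _ _

theorem galoisCochain_apply (hF : IsGaloisCovering k G F) (M : CatBimodule k B) (s : G) (n : ℕ)
    (f : Cochain (M.lift F) n) (x : Fin (n + 1) → C)
    (c : ∀ j : Fin n, x j.castSucc ⟶ x j.succ) :
    galoisCochain hF M s n f x c =
      M.liftCast F (hF.obj_smul s⁻¹ (x (Fin.last n))) (hF.obj_smul s⁻¹ (x 0))
        (f (fun i => s⁻¹ • x i) fun j => hom (k := k) s⁻¹ (c j)) := rfl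

theorem galoisCochain_coface (hF : IsGaloisCovering k G F) (M : CatBimodule k B) (s : G)
    {m n : ℕ} (θ : Fin (m + 1) →o Fin (n + 1)) :
    galoisCochain hF M s n ∘ₗ coface (M.lift F) θ =
      coface (M.lift F) θ ∘ₗ galoisCochain hF M s m := by
  refine LinearMap.ext fun f => funext fun x => MultilinearMap.ext fun c => ?_
  rw [LinearMap.comp_apply, LinearMap.comp_apply, galoisCochain_apply, coface_apply,
    coface_apply, galoisCochain_apply]
  have hp : pull θ (fun i => s⁻¹ • x i) (fun j => hom (k := k) s⁻¹ (c j)) =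
      fun j => hom (k := k) s⁻¹ (pull θ x c j) := by
    funext j; exact seg_hom s⁻¹ x c _
  rw [hp, seg_hom, seg_hom,
    M.liftCast_left F (hF.obj_smul s⁻¹ _) _ _ _ _ (hF.map_hom s⁻¹ _),
    M.liftCast_right F _ _ (hF.obj_smul s⁻¹ _) _ _ (hF.map_hom s⁻¹ _)]

/-- The value of a cochain is compatible with equalities between sequences of objects. -/
theorem cochain_cast (M : CatBimodule k C) {n : ℕ} (f : Cochain M n)
    (x x' : Fin (n + 1) → C) (h : ∀ i, x i = x' i) (c : ∀ j : Fin n, x j.castSucc ⟶ x j.succ) :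
    M.cast (h _) (h _) (f x c) =
      f x' fun j => eqToHom (h _).symm ≫ c j ≫ eqToHom (h _) := by
  obtain rfl : x = x' := funext h
  refine (M.cast_rfl _).trans ?_
  congr 1
  funext j
  simp

theorem galoisCochain_one (hF : IsGaloisCovering k G F) (M : CatBimodule k B) (n : ℕ) :
    galoisCochain hF M (1 : G) n = LinearMap.id := by
  refine LinearMap.ext fun f => funext fun x => MultilinearMap.ext fun c => ?_
  have h : ∀ i, (1 : G)⁻¹ • x i = x i := fun i => by rw [inv_one, one_smul]
  rw [galoisCochain_apply, M.liftCast_eq_cast F (h _) (h _), cochain_cast _ f _ x h]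
  have key : ∀ (t : G) (ht : t = 1) {y z : C} (d : y ⟶ z), hom (k := k) t d =
      eqToHom (by rw [ht, one_smul]) ≫ d ≫ eqToHom (by rw [ht, one_smul]) := by
    intro t ht y z d; subst ht; exact one_hom d
  simp [key 1⁻¹ inv_one]

theorem galoisCochain_mul (hF : IsGaloisCovering k G F) (M : CatBimodule k B) (s t : G) (n : ℕ) :
    galoisCochain hF M (s * t) n = galoisCochain hF M s n ∘ₗ galoisCochain hF M t n := by
  refine LinearMap.ext fun f => funext fun x => MultilinearMap.ext fun c => ?_
  have h : ∀ y : C, (s * t)⁻¹ • y = t⁻¹ • s⁻¹ • y := fun y => by rw [mul_inv_rev, mul_smul]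
  have key : ∀ {y z : C} (d : y ⟶ z), hom (k := k) t⁻¹ (hom (k := k) s⁻¹ d) =
      eqToHom (h y).symm ≫ hom (k := k) (s * t)⁻¹ d ≫ eqToHom (h z) := by
    have : ∀ (r : G) (hr : r = t⁻¹ * s⁻¹) {y z : C} (d : y ⟶ z),
        hom (k := k) t⁻¹ (hom (k := k) s⁻¹ d) = eqToHom (by rw [hr, mul_smul]) ≫
          hom (k := k) r d ≫ eqToHom (by rw [hr, mul_smul]) := by
      intro r hr y z d
      subst hr
      rw [mul_hom]
      simp
    intro y z d
    exact this _ (mul_inv_rev s t) d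
  rw [LinearMap.comp_apply, galoisCochain_apply, galoisCochain_apply, galoisCochain_apply]
  simp only [key]
  rw [← cochain_cast _ f (fun i => (s * t)⁻¹ • x i) (fun i => t⁻¹ • s⁻¹ • x i) fun i => h (x i),
    ← M.liftCast_eq_cast F, CatBimodule.liftCast_liftCast, CatBimodule.liftCast_liftCast]

/-- The action of `s ∈ G` on the cosimplicial vector space of cochains. -/
def galoisCosimplicial (hF : IsGaloisCovering k G F) (M : CatBimodule k B) (s : G) :
    cosimplicial (M.lift F) ⟶ cosimplicial (M.lift F) where
  app n := ModuleCat.ofHom (galoisCochain hF M s n.len)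
  naturality _ _ θ := ModuleCat.hom_ext (galoisCochain_coface hF M s θ.toOrderHom)

theorem galoisCosimplicial_one (hF : IsGaloisCovering k G F) (M : CatBimodule k B) :
    galoisCosimplicial hF M (1 : G) = 𝟙 _ :=
  NatTrans.ext (funext fun n => ModuleCat.hom_ext (galoisCochain_one hF M n.len))

theorem galoisCosimplicial_mul (hF : IsGaloisCovering k G F) (M : CatBimodule k B) (s t : G) :
    galoisCosimplicial hF M (s * t) = galoisCosimplicial hF M t ≫ galoisCosimplicial hF M s :=
  NatTrans.ext (funext fun n => ModuleCat.hom_ext (galoisCochain_mul hF M s t n.len))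

/-- The map induced by `s ∈ G` on the cochain complex of `C` with coefficients in `LM`. -/
def galoisComplexMap (hF : IsGaloisCovering k G F) (M : CatBimodule k B) (s : G) :
    cochainComplex (M.lift F) ⟶ cochainComplex (M.lift F) :=
  (AlgebraicTopology.alternatingCofaceMapComplex (ModuleCat.{u} k)).map (galoisCosimplicial hF M s)

theorem galoisComplexMap_one (hF : IsGaloisCovering k G F) (M : CatBimodule k B) :
    galoisComplexMap hF M (1 : G) = 𝟙 _ :=
  (congrArg _ (galoisCosimplicial_one hF M)).trans (CategoryTheory.Functor.map_id _ _)

theorem galoisComplexMap_mul (hF : IsGaloisCovering k G F) (M : CatBimodule k B) (s t : G) :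
    galoisComplexMap hF M (s * t) = galoisComplexMap hF M t ≫ galoisComplexMap hF M s :=
  (congrArg _ (galoisCosimplicial_mul hF M s t)).trans (CategoryTheory.Functor.map_comp _ _ _)

/-- The `kG`-module `H^q(C, LM)`. -/
def galoisRep (hF : IsGaloisCovering k G F) (M : CatBimodule k B) (q : ℕ) : Rep.{u} k G :=
  Rep.of (X := cohomology (M.lift F) q)
    { toFun := fun s =>
        (HomologicalComplex.homologyMap (galoisComplexMap hF M s) q).hom
      map_one' := by
        rw [galoisComplexMap_one, HomologicalComplex.homologyMap_id]
        rfl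
      map_mul' := fun s t => by
        rw [galoisComplexMap_mul, HomologicalComplex.homologyMap_comp]
        rfl }

end GaloisAction

end HochschildMitchell

/-- A first quadrant cohomological spectral sequence `E` converges to `H` if every `H n` has a
finite decreasing filtration `H n = Fil 0 ⊇ Fil 1 ⊇ ⋯ ⊇ Fil (n + 1) = 0` with
`Fil p / Fil (p + 1) ≅ E_∞^{p, n - p}`. Here `E_∞^{p, q}` is `E_r^{p, q}` for any `r > p` with
`r > q + 1`: the differentials into and out of `E_r^{p, q}` vanish for such `r`. -/
def CategoryTheory.SpectralSequence.ConvergesTo {k : Type u} [Field k]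
    (E : E₂CohomologicalSpectralSequenceNat (ModuleCat.{u} k)) (H : ℕ → ModuleCat.{u} k) : Prop :=
  ∀ n : ℕ, ∃ Fil : ℕ → Submodule k (H n), Antitone Fil ∧ Fil 0 = ⊤ ∧ Fil (n + 1) = ⊥ ∧
    ∀ p q : ℕ, p + q = n → ∀ (r : ℤ) (hr : 2 ≤ r), p < r → q + 1 < r →
      Nonempty ((E.page r hr).X (p, q) ≃ₗ[k] Fil p ⧸ (Fil (p + 1)).submoduleOf (Fil p))

end

/-!
The covering gives a first quadrant bicomplex with terms `C^p(G, C^q(C, LM))`, the inhomogeneous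
`p`-cochains of `G` with values in the Hochschild-Mitchell `q`-cochains of `C`. The spectral
sequence of the theorem is the one of its total complex, filtered by `p`.

*The second page.* Since `C^p(G, -)` is a power of the identity functor, it is exact, so the first
page is `C^p(G, H^q(C, LM))` and the second one is `H^p(G, H^q(C, LM))`. This is read off directly
on `Z₂ / (Z₁ + d Z₁)`: an element of `Z₂` is sent to the class of its component in the lowest column
(`EquivariantComplex.toGroupCohomology`, `EquivariantComplex.pageTwoIso`).

*The abutment.* The rows of the bicomplex compute the cohomology of `G` with values in
`C^q(C, LM)`. A `q`-cochain of `C` is a family indexed by the sequences of `q + 1` objects, on which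
`G` acts freely. Such a product over a free `G`-set has no cohomology in positive degrees
(`groupCohomology.exists_d_eq_of_diagonal`), so the total complex has the cohomology of the complex
of invariant cochains (`FirstQuadrantBicomplex.exists_toHomology`).

*The invariants.* For every object `x` of `C`, a morphism of `B` with source `F x` is in a unique
way a sum of images of morphisms of `C` with source `x`, one for each target. Hence a multilinear
map on the paths of `B` is the same as a family of multilinear maps on the paths of `C` with a given
starting object (`IsGaloisCovering.injective_restrictPaths`,
`IsGaloisCovering.surjective_restrictPaths`).
As the action on the objects over a given object of `B` is simply transitive, restriction along `F`
identifies `C^n(B, M)` with the invariants of `C^n(C, LM)`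
(`HochschildMitchell.exists_restrictCochain_eq`).

The spectral sequence of a filtered complex is constructed with elements: a filtered complex is
a single vector space with an endomorphism `d` and a family of subspaces `fil p n`
(`FilteredDifferential`), and all the terms of the pages are subquotients of it, so that no
identification between terms of equal degree is needed.
-/

noncomputable section

/-! ### Homology classes in complexes of vector spaces -/

namespace HomologicalComplex

variable {k : Type u} [Field k] {ι : Type*} {c : ComplexShape ι}

/-- The cycles of a complex of vector spaces in degree `i`, as a subspace of `K.X i`. -/
def cycleSubmodule (K : HomologicalComplex (ModuleCat.{u} k) c) (i : ι) :
    Submodule k (K.X i) where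
  carrier := {x | ∀ j, (K.d i j).hom x = 0}
  add_mem' hx hy j := by rw [map_add, hx j, hy j, add_zero]
  zero_mem' j := map_zero _
  smul_mem' r x hx j := by rw [map_smul, hx j, smul_zero]

/-- The comparison of the subspace of cycles with the cycles object of the complex. -/
def cycleSubmoduleMap (K : HomologicalComplex (ModuleCat.{u} k) c) (i : ι) :
    K.cycleSubmodule i →ₗ[k] K.cycles i :=
  (K.liftCycles (ModuleCat.ofHom (K.cycleSubmodule i).subtype) (c.next i) rfl
    (ModuleCat.hom_ext (LinearMap.ext fun x => x.2 _))).hom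

theorem iCycles_cycleSubmoduleMap (K : HomologicalComplex (ModuleCat.{u} k) c) (i : ι)
    (x : K.cycleSubmodule i) : (K.iCycles i).hom (K.cycleSubmoduleMap i x) = x.1 :=
  LinearMap.congr_fun (congrArg ModuleCat.Hom.hom
    (K.liftCycles_i (ModuleCat.ofHom (K.cycleSubmodule i).subtype) (c.next i) rfl
      (ModuleCat.hom_ext (LinearMap.ext fun x => x.2 _)))) x

theorem iCycles_injective (K : HomologicalComplex (ModuleCat.{u} k) c) (i : ι) :
    Function.Injective (K.iCycles i).hom :=
  (ModuleCat.mono_iff_injective (K.iCycles i)).1 inferInstance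

/-- The map sending a cycle to its homology class. -/
def homologyClass (K : HomologicalComplex (ModuleCat.{u} k) c) (i : ι) :
    K.cycleSubmodule i →ₗ[k] K.homology i :=
  (K.homologyπ i).hom ∘ₗ K.cycleSubmoduleMap i

theorem homologyClass_surjective (K : HomologicalComplex (ModuleCat.{u} k) c) (i : ι) :
    Function.Surjective (K.homologyClass i) := by
  intro h
  obtain ⟨z, rfl⟩ := (ModuleCat.epi_iff_surjective (K.homologyπ i)).1 inferInstance h
  refine ⟨⟨(K.iCycles i).hom z, fun j => ?_⟩, ?_⟩
  · exact LinearMap.congr_fun (congrArg ModuleCat.Hom.hom (K.iCycles_d i j)) z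
  · exact congrArg (K.homologyπ i).hom
      (K.iCycles_injective i (K.iCycles_cycleSubmoduleMap i _))

theorem homologyClass_eq_zero_iff (K : HomologicalComplex (ModuleCat.{u} k) c) (i : ι)
    (x : K.cycleSubmodule i) :
    K.homologyClass i x = 0 ↔ ∃ (j : ι) (y : K.X j), (K.d j i).hom y = x.1 := by
  have hex : (ShortComplex.mk (K.toCycles (c.prev i) i) (K.homologyπ i) (by simp)).Exact :=
    ShortComplex.exact_of_g_is_cokernel _ (K.homologyIsCokernel (c.prev i) i rfl)
  have hto : ∀ (j : ι) (y : K.X j),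
      (K.iCycles i).hom ((K.toCycles j i).hom y) = (K.d j i).hom y := fun j y =>
    LinearMap.congr_fun (congrArg ModuleCat.Hom.hom (K.toCycles_i j i)) y
  constructor
  · intro h
    obtain ⟨y, hy⟩ := (ShortComplex.moduleCat_exact_iff _).1 hex (K.cycleSubmoduleMap i x) h
    refine ⟨_, y, ?_⟩
    rw [← K.iCycles_cycleSubmoduleMap i x, ← hy]
    exact (hto _ y).symm
  · rintro ⟨j, y, hy⟩
    have : (K.toCycles j i).hom y = K.cycleSubmoduleMap i x := by
      apply K.iCycles_injective i
      rw [K.iCycles_cycleSubmoduleMap i x, ← hy, hto]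
    rw [homologyClass, LinearMap.comp_apply, ← this]
    exact LinearMap.congr_fun (congrArg ModuleCat.Hom.hom (K.toCycles_comp_homologyπ j i)) y

theorem homologyMap_homologyClass {K L : HomologicalComplex (ModuleCat.{u} k) c} (f : K ⟶ L)
    (i : ι) (x : K.cycleSubmodule i) (hx : (f.f i).hom x.1 ∈ L.cycleSubmodule i) :
    (homologyMap f i).hom (K.homologyClass i x) = L.homologyClass i ⟨(f.f i).hom x.1, hx⟩ := by
  refine (LinearMap.congr_fun (congrArg ModuleCat.Hom.hom (homologyπ_naturality f i))
    (K.cycleSubmoduleMap i x)).trans ?_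
  refine congrArg (L.homologyπ i).hom (L.iCycles_injective i ?_)
  refine (LinearMap.congr_fun (congrArg ModuleCat.Hom.hom (cyclesMap_i f i))
    (K.cycleSubmoduleMap i x)).trans ?_
  rw [L.iCycles_cycleSubmoduleMap]
  exact congrArg (f.f i).hom (K.iCycles_cycleSubmoduleMap i x)

end HomologicalComplex

/-- Two surjective linear maps with the same kernel have isomorphic targets. -/
def LinearMap.equivOfSurjective {k A H H' : Type*} [Ring k] [AddCommGroup A] [Module k A]
    [AddCommGroup H] [Module k H] [AddCommGroup H'] [Module k H'] (f : A →ₗ[k] H) (g : A →ₗ[k] H')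
    (hf : Function.Surjective f) (hg : Function.Surjective g)
    (h : ∀ a, f a = 0 ↔ g a = 0) : H ≃ₗ[k] H' :=
  (f.quotKerEquivOfSurjective hf).symm ≪≫ₗ
    Submodule.quotEquivOfEq _ _ (Submodule.ext fun a => by simpa using h a) ≪≫ₗ
      g.quotKerEquivOfSurjective hg

/-- A surjective linear map identifies its target with the quotient of its source by its kernel. -/
def LinearMap.quotEquivOfSurjective {k A H : Type*} [Ring k] [AddCommGroup A] [Module k A]
    [AddCommGroup H] [Module k H] (f : A →ₗ[k] H) (hf : Function.Surjective f)
    (N : Submodule k A) (h : ∀ a, f a = 0 ↔ a ∈ N) : (A ⧸ N) ≃ₗ[k] H :=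
  Submodule.quotEquivOfEq _ _ (Submodule.ext fun a => by simpa using (h a).symm) ≪≫ₗ
    f.quotKerEquivOfSurjective hf

/-! ### The spectral sequence of a filtered complex -/

/-- A filtered cochain complex of `k`-vector spaces, encoded inside a single vector space `T` with
an endomorphism `d` of square zero: `fil p n` is the `p`-th step of the (decreasing) filtration in
degree `n`, and `fil 0 n` is the whole degree `n` part. The filtration is the one of a first
quadrant complex: it is constant for `p ≤ 0` and zero in degree `n` for `p > n`. -/
structure FilteredDifferential (k T : Type u) [Field k] [AddCommGroup T] [Module k T] where
  d : T →ₗ[k] T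
  fil : ℤ → ℤ → Submodule k T
  d_d (x : T) : d (d x) = 0
  anti {p p' n : ℤ} (h : p ≤ p') : fil p' n ≤ fil p n
  d_mem {p n : ℤ} {x : T} (h : x ∈ fil p n) : d x ∈ fil p (n + 1)
  fil_le_of_nonpos {p p' n : ℤ} (h : p ≤ 0) : fil p' n ≤ fil p n
  fil_eq_bot {p n : ℤ} (h : n < p) : fil p n = ⊥

namespace FilteredDifferential

variable {k T : Type u} [Field k] [AddCommGroup T] [Module k T] (A : FilteredDifferential k T)

/-- The elements of `fil p n` with differential in `fil (p + r)`. -/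
def Z (r p n : ℤ) : Submodule k T := A.fil p n ⊓ (A.fil (p + r) (n + 1)).comap A.d

theorem mem_Z {r p n : ℤ} {x : T} :
    x ∈ A.Z r p n ↔ x ∈ A.fil p n ∧ A.d x ∈ A.fil (p + r) (n + 1) := Iff.rfl

/-- The denominator of the term `E_r` of the spectral sequence. -/
def D (r p n : ℤ) : Submodule k T :=
  A.Z (r - 1) (p + 1) n ⊔ (A.Z (r - 1) (p - r + 1) (n - 1)).map A.d

theorem mem_D {r p n : ℤ} {x : T} :
    x ∈ A.D r p n ↔ ∃ b ∈ A.Z (r - 1) (p + 1) n, ∃ c ∈ A.Z (r - 1) (p - r + 1) (n - 1),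
      b + A.d c = x := by
  simp [D, Submodule.mem_sup]

/-- The term `E_r` of the spectral sequence in filtration degree `p` and total degree `n`. -/
abbrev E (r p n : ℤ) : Type u := A.Z r p n ⧸ (A.D r p n).submoduleOf (A.Z r p n)

/-- The class in `E_r` of an element of `Z_r`. -/
def cls (r p n : ℤ) : A.Z r p n →ₗ[k] A.E r p n := Submodule.mkQ _

theorem cls_surjective (r p n : ℤ) : Function.Surjective (A.cls r p n) :=
  Submodule.mkQ_surjective _

theorem cls_eq_zero_iff {r p n : ℤ} (x : A.Z r p n) : A.cls r p n x = 0 ↔ x.1 ∈ A.D r p n := by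
  exact Submodule.Quotient.mk_eq_zero _

theorem d_mem_Z {r p n p' n' : ℤ} (hp : p + r = p') (hn : n + 1 = n') {x : T}
    (hx : x ∈ A.Z r p n) : A.d x ∈ A.Z r p' n' := by
  subst hp hn
  exact A.mem_Z.2 ⟨hx.2, by rw [A.d_d]; exact zero_mem _⟩

theorem d_mem_D {r p n p' n' : ℤ} (hp : p + r = p') (hn : n + 1 = n') {x : T}
    (hx : x ∈ A.D r p n) : A.d x ∈ A.D r p' n' := by
  obtain ⟨b, hb, c, -, rfl⟩ := A.mem_D.1 hx
  refine A.mem_D.2 ⟨0, zero_mem _, b, ?_, by simp [A.d_d]⟩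
  rwa [show p' - r + 1 = p + 1 by lia, show n' - 1 = n by lia]

/-- The differential of the term `E_r`, which is induced by `d`. -/
def dE {r p n p' n' : ℤ} (hp : p + r = p') (hn : n + 1 = n') : A.E r p n →ₗ[k] A.E r p' n' :=
  Submodule.mapQ _ _ (A.d.restrict fun _ hx => A.d_mem_Z hp hn hx) fun _ hx =>
    A.d_mem_D hp hn hx

/-- The differential of the page `E_r` between two arbitrary positions. -/
def pageD (r : ℤ) (a b : ℕ × ℕ) :
    A.E r a.1 (a.1 + a.2) →ₗ[k] A.E r b.1 (b.1 + b.2) :=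
  open Classical in
  if h : (ComplexShape.spectralSequenceNat (r, 1 - r)).Rel a b then
    A.dE h.1 (by have h1 := h.1; have h2 := h.2; dsimp only at h1 h2; lia)
  else 0

theorem pageD_cls {r : ℤ} {a b : ℕ × ℕ}
    (h : (ComplexShape.spectralSequenceNat (r, 1 - r)).Rel a b) (x : A.Z r a.1 (a.1 + a.2))
    (hx : A.d x.1 ∈ A.Z r b.1 (b.1 + b.2)) :
    A.pageD r a b (A.cls _ _ _ x) = A.cls _ _ _ ⟨A.d x.1, hx⟩ := by
  rw [pageD, dif_pos h]
  rfl

theorem pageD_eq_zero {r : ℤ} {a b : ℕ × ℕ}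
    (h : ¬ (ComplexShape.spectralSequenceNat (r, 1 - r)).Rel a b) : A.pageD r a b = 0 := by
  rw [pageD, dif_neg h]

/-- The page `E_r` of the spectral sequence. -/
def page (r : ℤ) :
    HomologicalComplex (ModuleCat.{u} k) (ComplexShape.spectralSequenceNat (r, 1 - r)) where
  X a := ModuleCat.of k (A.E r a.1 (a.1 + a.2))
  d a b := ModuleCat.ofHom (A.pageD r a b)
  shape a b h := by rw [A.pageD_eq_zero h]; rfl
  d_comp_d' a b c hab hbc := by
    refine ModuleCat.hom_ext (LinearMap.ext fun e => ?_)
    obtain ⟨x, rfl⟩ := A.cls_surjective _ _ _ e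
    change A.pageD r b c (A.pageD r a b _) = 0
    have h1 := hab.1; have h2 := hab.2; have h3 := hbc.1; have h4 := hbc.2
    dsimp only at h1 h2 h3 h4
    have hx := A.d_mem_Z (p' := b.1) (n' := b.1 + b.2) (by lia) (by lia) x.2
    rw [A.pageD_cls hab x hx,
      A.pageD_cls hbc _ (A.d_mem_Z (p' := c.1) (n' := c.1 + c.2) (by lia) (by lia) hx),
      A.cls_eq_zero_iff]
    change A.d (A.d x.1) ∈ _
    rw [A.d_d]
    exact zero_mem _

theorem Z_succ_le (r p n : ℤ) : A.Z (r + 1) p n ≤ A.Z r p n := fun _ hx =>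
  ⟨hx.1, A.anti (by lia) hx.2⟩

theorem mem_Z_of_eq {r p n r' p' n' : ℤ} {x : T} (hx : x ∈ A.Z r p n) (hr : r = r' := by lia)
    (hp : p = p' := by lia) (hn : n = n' := by lia) : x ∈ A.Z r' p' n' := by
  subst hr hp hn; exact hx

theorem mem_fil_of_eq {p n p' n' : ℤ} {x : T} (hx : x ∈ A.fil p n) (hp : p' ≤ p := by lia)
    (hn : n = n' := by lia) : x ∈ A.fil p' n' := by
  subst hn; exact A.anti hp hx

theorem cls_mem_cycleSubmodule {r : ℤ} (a : ℕ × ℕ)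
    (x : A.Z (r + 1) a.1 (a.1 + a.2)) :
    A.cls r a.1 (a.1 + a.2) ⟨x.1, A.Z_succ_le _ _ _ x.2⟩ ∈ (A.page r).cycleSubmodule a := by
  intro b
  change A.pageD r a b _ = 0
  by_cases h : (ComplexShape.spectralSequenceNat (r, 1 - r)).Rel a b
  · have h1 := h.1; have h2 := h.2; dsimp only at h1 h2
    rw [A.pageD_cls h _ (A.d_mem_Z (p' := b.1) (n' := b.1 + b.2) (by lia) (by lia)
      (A.Z_succ_le _ _ _ x.2)), A.cls_eq_zero_iff]
    refine Submodule.mem_sup_left (A.mem_Z.2 ⟨A.mem_fil_of_eq x.2.2, ?_⟩)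
    rw [A.d_d]
    exact zero_mem _
  · rw [A.pageD_eq_zero h]; rfl

/-- The map from `Z_{r + 1}` to the homology of `E_r`. -/
def toHomology (r : ℤ) (a : ℕ × ℕ) :
    A.Z (r + 1) a.1 (a.1 + a.2) →ₗ[k] (A.page r).homology a :=
  (A.page r).homologyClass a ∘ₗ
    LinearMap.codRestrict _ (A.cls r a.1 (a.1 + a.2) ∘ₗ Submodule.inclusion (A.Z_succ_le _ _ _))
      (A.cls_mem_cycleSubmodule a)

/-- A class of `E_r` killed by the differential is represented in `Z_{r + 1}`. -/
theorem toHomology_surjective {r : ℤ} (hr : 2 ≤ r) (a : ℕ × ℕ) :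
    Function.Surjective (A.toHomology r a) := by
  intro e
  obtain ⟨⟨e, he⟩, rfl⟩ := (A.page r).homologyClass_surjective a e
  obtain ⟨⟨x, hx⟩, rfl⟩ := A.cls_surjective _ _ _ e
  suffices ∃ y, ∃ hy : y ∈ A.Z (r + 1) a.1 (a.1 + a.2), x - y ∈ A.D r a.1 (a.1 + a.2) by
    obtain ⟨y, hy, hxy⟩ := this
    refine ⟨⟨y, hy⟩, congrArg ((A.page r).homologyClass a) (Subtype.ext ?_)⟩
    refine (sub_eq_zero.1 ?_).symm
    exact (map_sub (A.cls r a.1 (a.1 + a.2)) _ _).symm.trans ((A.cls_eq_zero_iff _).2 hxy)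
  by_cases hq : (r : ℤ) ≤ a.2 + 1
  · obtain ⟨b, hb⟩ : ∃ b, (ComplexShape.spectralSequenceNat (r, 1 - r)).Rel a b :=
      ⟨((a.1 + r).toNat, (a.2 + 1 - r).toNat), by
        constructor <;> dsimp only <;> lia⟩
    have h1 := hb.1; have h2 := hb.2; dsimp only at h1 h2
    have h0 : A.pageD r a b _ = 0 := he b
    rw [A.pageD_cls hb _ (A.d_mem_Z (p' := b.1) (n' := b.1 + b.2) (by lia) (by lia) hx),
      A.cls_eq_zero_iff, A.mem_D] at h0
    obtain ⟨y, hy, c, hc, hyc⟩ := h0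
    have hc' : c ∈ A.Z (r - 1) (a.1 + 1) (a.1 + a.2) := A.mem_Z_of_eq hc
    have hyc' : A.d (x - c) = y := by rw [map_sub]; exact sub_eq_iff_eq_add.2 hyc.symm
    refine ⟨x - c, A.mem_Z.2 ⟨sub_mem hx.1 (A.anti (by lia) hc'.1), ?_⟩, ?_⟩
    · rw [hyc']
      exact A.mem_fil_of_eq hy.1
    · rw [sub_sub_cancel]
      exact Submodule.mem_sup_left hc'
  · -- no differential starts here, but `fil (p + r)` vanishes in degree `p + q + 1`
    have h0 := (A.mem_Z.1 hx).2
    rw [A.fil_eq_bot (by lia), Submodule.mem_bot] at h0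
    exact ⟨x, A.mem_Z.2 ⟨hx.1, h0 ▸ zero_mem _⟩, by simp⟩

/-- An element of `Z_{r + 1}` whose class in `E_r` is a boundary lies in the denominator of
`E_{r + 1}`, and conversely. -/
theorem toHomology_eq_zero_iff {r : ℤ} (hr : 2 ≤ r) (a : ℕ × ℕ)
    (x : A.Z (r + 1) a.1 (a.1 + a.2)) :
    A.toHomology r a x = 0 ↔ x.1 ∈ A.D (r + 1) a.1 (a.1 + a.2) := by
  rw [toHomology, LinearMap.comp_apply, HomologicalComplex.homologyClass_eq_zero_iff]
  have hcls : ∀ (y : T) (hy : y ∈ A.Z r a.1 (a.1 + a.2)),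
      A.cls _ _ _ ⟨y, hy⟩ = A.cls r a.1 (a.1 + a.2) ⟨x.1, A.Z_succ_le _ _ _ x.2⟩ ↔
        x.1 - y ∈ A.D r a.1 (a.1 + a.2) := fun y hy => by
    rw [eq_comm, ← sub_eq_zero, ← map_sub, A.cls_eq_zero_iff]
    rfl
  constructor
  · rintro ⟨b, e, he⟩
    change A.pageD r b a e = A.cls _ _ _ _ at he
    obtain ⟨y, hy, hxy⟩ : ∃ y ∈ A.Z r (a.1 - r) (a.1 + a.2 - 1),
        x.1 - A.d y ∈ A.D r a.1 (a.1 + a.2) := by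
      by_cases h : (ComplexShape.spectralSequenceNat (r, 1 - r)).Rel b a
      · have h1 := h.1; have h2 := h.2; dsimp only at h1 h2
        obtain ⟨⟨y, hy⟩, rfl⟩ := A.cls_surjective _ _ _ e
        rw [A.pageD_cls h _ (A.d_mem_Z (by lia) (by lia) hy)] at he
        exact ⟨y, A.mem_Z_of_eq hy, (hcls _ _).1 he⟩
      · rw [A.pageD_eq_zero h] at he
        replace he := (A.cls_eq_zero_iff _).1 he.symm
        exact ⟨0, zero_mem _, by simpa using he⟩
    obtain ⟨b', hb', c, hc, hbc⟩ := A.mem_D.1 hxy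
    have hsum : b' + A.d (c + y) = x.1 := by
      rw [map_add, ← add_assoc, hbc, sub_add_cancel]
    refine A.mem_D.2 ⟨b', A.mem_Z.2 ⟨hb'.1, ?_⟩, c + y, add_mem ?_ (A.mem_Z_of_eq hy), hsum⟩
    · rw [show A.d b' = A.d x.1 by rw [← hsum]; simp [A.d_d]]
      exact A.mem_fil_of_eq x.2.2
    · exact ⟨A.mem_fil_of_eq hc.1, A.mem_fil_of_eq hc.2⟩
  · intro hx
    obtain ⟨b', hb', c, hc, hbc⟩ := A.mem_D.1 hx
    replace hb' : b' ∈ A.Z (r - 1) (a.1 + 1) (a.1 + a.2) :=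
      ⟨hb'.1, A.mem_fil_of_eq hb'.2⟩
    replace hc : c ∈ A.Z r (a.1 - r) (a.1 + a.2 - 1) := A.mem_Z_of_eq hc
    by_cases hp : r ≤ a.1
    · obtain ⟨b, hb⟩ : ∃ b, (ComplexShape.spectralSequenceNat (r, 1 - r)).Rel b a :=
        ⟨((a.1 - r).toNat, (a.2 + r - 1).toNat), by
          constructor <;> dsimp only <;> lia⟩
      have h1 := hb.1; have h2 := hb.2; dsimp only at h1 h2
      have hc' : c ∈ A.Z r b.1 (b.1 + b.2) := A.mem_Z_of_eq hc
      refine ⟨b, A.cls _ _ _ ⟨c, hc'⟩, ?_⟩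
      change A.pageD r b a _ = A.cls _ _ _ _
      rw [A.pageD_cls hb _ (A.d_mem_Z (by lia) (by lia) hc')]
      refine (hcls _ _).2 ?_
      rw [← hbc, add_sub_cancel_right]
      exact Submodule.mem_sup_left hb'
    · -- no differential of `E_r` ends here, and the class itself vanishes
      refine ⟨a, 0, ?_⟩
      rw [map_zero]
      refine Eq.symm ((A.cls_eq_zero_iff _).2 (A.mem_D.2 ⟨b', hb', c, ?_, hbc⟩))
      -- the filtration is constant for `p ≤ 0`, so `c` may be shifted by one step
      have hdc : A.d c ∈ A.fil a.1 (a.1 + a.2) := by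
        rw [← sub_eq_iff_eq_add'.2 hbc.symm]
        exact sub_mem x.2.1 (A.anti (by lia) hb'.1)
      exact ⟨A.fil_le_of_nonpos (by lia) hc.1, A.mem_fil_of_eq hdc⟩

/-- The homology of the page `E_r` is the page `E_{r + 1}`. -/
def pageIso {r : ℤ} (hr : 2 ≤ r) (a : ℕ × ℕ) :
    (A.page r).homology a ≅ (A.page (r + 1)).X a :=
  LinearEquiv.toModuleIso (LinearMap.quotEquivOfSurjective (A.toHomology r a)
    (A.toHomology_surjective hr a) ((A.D (r + 1) a.1 (a.1 + a.2)).submoduleOf _)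
    (A.toHomology_eq_zero_iff hr a)).symm

/-- The spectral sequence of a filtered complex, from the second page on. -/
def spectralSequence : E₂CohomologicalSpectralSequenceNat (ModuleCat.{u} k) where
  page r _ := A.page r
  iso r r' a hrr' hr := A.pageIso hr a ≪≫ eqToIso (by rw [hrr'])

/-- The cycles of degree `n`. -/
def cyc (n : ℤ) : Submodule k T := A.fil 0 n ⊓ LinearMap.ker A.d

theorem mem_cyc {n : ℤ} {x : T} : x ∈ A.cyc n ↔ x ∈ A.fil 0 n ∧ A.d x = 0 := Iff.rfl

/-- A linear map from the cycles of degree `n` which is surjective and whose kernel is the space of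
boundaries identifies its target with the cohomology; the spectral sequence then converges to this
target, for the filtration by the images of the cycles in `fil p`. -/
theorem convergesTo (H : ℕ → ModuleCat.{u} k) (ω : ∀ n : ℕ, A.cyc n →ₗ[k] H n)
    (hω : ∀ n, Function.Surjective (ω n))
    (hker : ∀ n x, ω n x = 0 ↔ ∃ c ∈ A.fil 0 (n - 1), A.d c = x.1) :
    A.spectralSequence.ConvergesTo H := by
  intro n
  let Fil : ℕ → Submodule k (H n) := fun p => ((A.fil p n).submoduleOf (A.cyc n)).map (ω n)
  refine ⟨Fil, ?_, ?_, ?_, ?_⟩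
  · intro p p' h
    exact Submodule.map_mono fun x hx => A.anti (by exact_mod_cast h) hx
  · refine eq_top_iff.2 fun h _ => ?_
    obtain ⟨x, rfl⟩ := hω n h
    exact ⟨x, x.2.1, rfl⟩
  · refine eq_bot_iff.2 ?_
    rintro _ ⟨x, hx, rfl⟩
    have hx' : x.1 ∈ A.fil ((n + 1 : ℕ) : ℤ) n := hx
    rw [A.fil_eq_bot (by push_cast; lia), Submodule.mem_bot] at hx'
    rw [Submodule.mem_bot, hker]
    exact ⟨0, zero_mem _, by rw [hx', map_zero]⟩
  · intro p q hpq r hr hp hq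
    have hZ : ∀ x ∈ A.Z r p (p + q), x ∈ A.cyc n := fun x hx => by
      have h := (A.mem_Z.1 hx).2
      rw [A.fil_eq_bot (by lia), Submodule.mem_bot] at h
      exact ⟨A.mem_fil_of_eq hx.1, h⟩
    have hmem : ∀ x : A.Z r p (p + q), ω n ⟨x.1, hZ x.1 x.2⟩ ∈ Fil p := fun x =>
      ⟨⟨x.1, hZ x.1 x.2⟩, A.mem_fil_of_eq (p := p) x.2.1, rfl⟩
    let f : A.Z r p (p + q) →ₗ[k] Fil p :=
      LinearMap.codRestrict (Fil p) (ω n ∘ₗ Submodule.inclusion hZ) hmem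
    refine ⟨LinearMap.quotEquivOfSurjective (Submodule.mkQ ((Fil (p + 1)).submoduleOf (Fil p)) ∘ₗ f)
      ?_ ((A.D r p (p + q)).submoduleOf _) ?_⟩
    · refine (Submodule.mkQ_surjective _).comp ?_
      rintro ⟨_, x, hx, rfl⟩
      have hx' : x.1 ∈ A.Z r p (p + q) := by
        refine A.mem_Z.2 ⟨A.mem_fil_of_eq (p := p) hx, ?_⟩
        rw [(A.mem_cyc.1 x.2).2]
        exact zero_mem _
      exact ⟨⟨x.1, hx'⟩, rfl⟩
    · intro x
      rw [LinearMap.comp_apply, Submodule.mkQ_apply, Submodule.Quotient.mk_eq_zero]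
      change ω n ⟨x.1, hZ x.1 x.2⟩ ∈ Fil (p + 1) ↔ x.1 ∈ A.D r p (p + q)
      constructor
      · rintro ⟨y, hy, hxy⟩
        have hy' : y.1 ∈ A.fil ((p + 1 : ℕ) : ℤ) n := hy
        obtain ⟨c, hc, hdc⟩ := (hker n (⟨x.1, hZ x.1 x.2⟩ - y)).1 (by rw [map_sub, hxy, sub_self])
        replace hdc : A.d c = x.1 - y.1 := hdc
        have hyx : A.d c ∈ A.fil p n := by
          rw [hdc]
          exact sub_mem (A.mem_fil_of_eq x.2.1) (A.mem_fil_of_eq hy')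
        refine A.mem_D.2 ⟨y.1, A.mem_Z.2 ⟨A.mem_fil_of_eq hy', ?_⟩, c, A.mem_Z.2 ⟨?_, ?_⟩, ?_⟩
        · rw [(A.mem_cyc.1 y.2).2]
          exact zero_mem _
        · exact A.fil_le_of_nonpos (by lia) (A.mem_fil_of_eq hc le_rfl)
        · exact A.mem_fil_of_eq hyx
        · rw [hdc]; abel
      · intro hx
        obtain ⟨y, hy, c, hc, hyc⟩ := A.mem_D.1 hx
        have hdy : A.d y = 0 := by
          have h := (A.mem_Z.1 hy).2
          rwa [A.fil_eq_bot (by lia), Submodule.mem_bot] at h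
        have hy0 : y ∈ A.cyc n := ⟨A.mem_fil_of_eq hy.1, hdy⟩
        refine ⟨⟨y, hy0⟩, A.mem_fil_of_eq (p := p + 1) hy.1 (by push_cast; lia), ?_⟩
        refine (sub_eq_zero.1 ?_).symm
        rw [← map_sub, hker]
        have hc' : c ∈ A.fil (p - r + 1) (n - 1) := A.mem_fil_of_eq hc.1 le_rfl
        refine ⟨c, A.fil_le_of_nonpos le_rfl hc', ?_⟩
        exact sub_eq_iff_eq_add'.2 hyc.symm |>.symm

end FilteredDifferential

/-! ### First quadrant bicomplexes and their total complexes -/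

/-- A first quadrant bicomplex of vector spaces, with anticommuting differentials. -/
structure FirstQuadrantBicomplex (k : Type u) [Field k] where
  X : ℕ → ℕ → Type u
  [addCommGroup : ∀ p q, AddCommGroup (X p q)]
  [module : ∀ p q, Module k (X p q)]
  dh {p q : ℕ} : X p q →ₗ[k] X (p + 1) q
  dv {p q : ℕ} : X p q →ₗ[k] X p (q + 1)
  dh_dh {p q : ℕ} (x : X p q) : dh (dh x) = 0
  dv_dv {p q : ℕ} (x : X p q) : dv (dv x) = 0
  dh_dv_add_dv_dh {p q : ℕ} (x : X p q) : dh (dv x) + dv (dh x) = 0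

attribute [instance] FirstQuadrantBicomplex.addCommGroup FirstQuadrantBicomplex.module

namespace FirstQuadrantBicomplex

variable {k : Type u} [Field k] (B : FirstQuadrantBicomplex k)

/-- The product of all the terms of the bicomplex, which contains the terms of every degree of the
total complex. -/
abbrev Total : Type u := ∀ p q, B.X p q

/-- The horizontal part of the total differential. -/
def totalH (t : B.Total) : B.Total
  | 0, _ => 0
  | p + 1, q => B.dh (t p q)

/-- The vertical part of the total differential. -/
def totalV (t : B.Total) : B.Total
  | _, 0 => 0
  | p, q + 1 => B.dv (t p q)

/-- The total differential. -/
def totalD : B.Total →ₗ[k] B.Total where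
  toFun t := B.totalH t + B.totalV t
  map_add' s t := by
    funext p q
    rcases p with _ | p <;> rcases q with _ | q <;> simp [totalH, totalV]
    abel
  map_smul' r t := by
    funext p q
    rcases p with _ | p <;> rcases q with _ | q <;> simp [totalH, totalV]

theorem totalD_apply (t : B.Total) (p q : ℕ) :
    B.totalD t p q = B.totalH t p q + B.totalV t p q := rfl

theorem dh_totalH (t : B.Total) (p q : ℕ) : B.dh (B.totalH t p q) = 0 := by
  rcases p with _ | p
  · exact map_zero _
  · exact B.dh_dh _

theorem dv_totalV (t : B.Total) (p q : ℕ) : B.dv (B.totalV t p q) = 0 := by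
  rcases q with _ | q
  · exact map_zero _
  · exact B.dv_dv _

theorem totalD_totalD (t : B.Total) : B.totalD (B.totalD t) = 0 := by
  funext p q
  rw [totalD_apply]
  rcases p with _ | p <;> rcases q with _ | q
  · exact add_zero _
  · change 0 + B.dv (B.totalD t 0 q) = 0
    rw [totalD_apply, map_add, dv_totalV]
    simp [totalH]
  · change B.dh (B.totalD t p 0) + 0 = 0
    rw [totalD_apply, map_add, dh_totalH]
    simp [totalV]
  · change B.dh (B.totalD t p (q + 1)) + B.dv (B.totalD t (p + 1) q) = 0
    rw [totalD_apply, totalD_apply, map_add, map_add, dv_totalV, dh_totalH, zero_add, add_zero]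
    exact B.dh_dv_add_dv_dh _

/-- The elements of degree `n` of the total complex supported in the columns from the `p`-th on. -/
def totalFil (p n : ℤ) : Submodule k B.Total where
  carrier := {t | ∀ i j : ℕ, ¬ (p ≤ i ∧ i + j = n) → t i j = 0}
  add_mem' hs ht i j h := by rw [Pi.add_apply, Pi.add_apply, hs i j h, ht i j h, add_zero]
  zero_mem' _ _ _ := rfl
  smul_mem' r t ht i j h := by rw [Pi.smul_apply, Pi.smul_apply, ht i j h, smul_zero]

theorem totalH_eq_zero {p n : ℤ} {t : B.Total} (ht : t ∈ B.totalFil p n) {i : ℕ} (hi : i ≤ p)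
    (j : ℕ) : B.totalH t i j = 0 := by
  rcases i with _ | i
  · rfl
  · exact (congrArg B.dh (ht i j (by push_cast at hi; lia))).trans (map_zero _)

/-- The total complex of a first quadrant bicomplex, filtered by columns. -/
@[simps]
def total : FilteredDifferential k B.Total where
  d := B.totalD
  fil := B.totalFil
  d_d := B.totalD_totalD
  anti h t ht i j hij := ht i j fun h' => hij ⟨h.trans h'.1, h'.2⟩
  d_mem {p n t} ht i j hij := by
    rw [totalD_apply]
    have h1 : B.totalH t i j = 0 := by
      rcases i with _ | i
      · rfl
      · exact (congrArg B.dh (ht i j (by push_cast at hij; lia))).trans (map_zero _)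
    have h2 : B.totalV t i j = 0 := by
      rcases j with _ | j
      · rfl
      · exact (congrArg B.dv (ht i j (by push_cast at hij; lia))).trans (map_zero _)
    rw [h1, h2, add_zero]
  fil_le_of_nonpos h t ht i j hij := ht i j (by lia)
  fil_eq_bot h := eq_bot_iff.2 fun t ht => funext fun i => funext fun j => ht i j (by lia)

/-- The inclusion of a term of the bicomplex. -/
def single (p q : ℕ) : B.X p q →ₗ[k] B.Total :=
  LinearMap.single k (fun p => ∀ q, B.X p q) p ∘ₗ LinearMap.single k (fun q => B.X p q) q

theorem single_same {p q : ℕ} (x : B.X p q) : B.single p q x p q = x := by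
  simp [single]

theorem single_of_ne {p q : ℕ} (x : B.X p q) {i j : ℕ} (h : ¬ (i = p ∧ j = q)) :
    B.single p q x i j = 0 := by
  by_cases hi : i = p
  · subst hi
    have hj : j ≠ q := fun hj => h ⟨rfl, hj⟩
    simp [single, hj]
  · simp [single, hi]

theorem totalD_single {p q : ℕ} (x : B.X p q) :
    B.totalD (B.single p q x) = B.single (p + 1) q (B.dh x) + B.single p (q + 1) (B.dv x) := by
  funext i j
  rw [totalD_apply, Pi.add_apply, Pi.add_apply]
  congr 1
  · rcases i with _ | i
    · exact (B.single_of_ne _ (by lia)).symm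
    · change B.dh (B.single p q x i j) = _
      by_cases h : i = p ∧ j = q
      · obtain ⟨rfl, rfl⟩ := h
        rw [single_same, single_same]
      · rw [B.single_of_ne _ h, B.single_of_ne _ (by lia), map_zero]
  · rcases j with _ | j
    · exact (B.single_of_ne _ (by lia)).symm
    · change B.dv (B.single p q x i j) = _
      by_cases h : i = p ∧ j = q
      · obtain ⟨rfl, rfl⟩ := h
        rw [single_same, single_same]
      · rw [B.single_of_ne _ h, B.single_of_ne _ (by lia), map_zero]

theorem single_mem {p q : ℕ} (x : B.X p q) {p' n : ℤ} (h : p' ≤ p) (hn : (p : ℤ) + q = n) :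
    B.single p q x ∈ B.totalFil p' n := fun i j hij =>
  B.single_of_ne x (by lia)

theorem eq_single {n : ℕ} {t : B.Total} (ht : t ∈ B.totalFil 0 n)
    (h : ∀ i j, 0 < i → t i j = 0) : t = B.single 0 n (t 0 n) := by
  funext i j
  by_cases hij : i = 0 ∧ j = n
  · obtain ⟨rfl, rfl⟩ := hij
    rw [single_same]
  · rw [B.single_of_ne _ hij]
    rcases Nat.eq_zero_or_pos i with rfl | hi
    · exact ht _ _ (by push_cast; lia)
    · exact h i j hi

/-- An element of `totalFil p n` lies in the next step if its component in the column `p`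
vanishes. -/
theorem mem_totalFil_succ {p q : ℕ} {n : ℤ} (hn : (p : ℤ) + q = n) {t : B.Total}
    (ht : t ∈ B.totalFil p n) (h : t p q = 0) : t ∈ B.totalFil (p + 1) n := by
  intro i j hij
  by_cases hi : i = p ∧ j = q
  · obtain ⟨rfl, rfl⟩ := hi
    exact h
  · exact ht i j (by lia)

/-- If the rows are exact in positive degrees, an element of the total complex whose differential
is supported in the column `0` can be moved to the column `0` by subtracting a boundary. -/
theorem exists_sub_totalD (hex : ∀ (p q : ℕ) (x : B.X (p + 1) q), B.dh x = 0 → ∃ y, B.dh y = x)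
    {n : ℤ} (m : ℕ) (t : B.Total) (ht : t ∈ B.totalFil 0 n)
    (hdt : ∀ i j, 0 < i → B.totalD t i j = 0) (hm : ∀ i j, m < i → t i j = 0) :
    ∃ s ∈ B.totalFil 0 (n - 1), ∀ i j, 0 < i → (t - B.totalD s) i j = 0 := by
  induction m generalizing t with
  | zero => exact ⟨0, zero_mem _, by simpa using hm⟩
  | succ m ih =>
    by_cases hn : (m : ℤ) + 1 ≤ n
    · -- `q` is the row of the only component of `t` in the column `m + 1`
      obtain ⟨q, hq⟩ : ∃ q : ℕ, (m : ℤ) + 1 + q = n := ⟨(n - m - 1).toNat, by lia⟩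
      obtain ⟨y, hy⟩ := hex m q (t (m + 1) q) (by
        have h := hdt (m + 2) q (by lia)
        rw [totalD_apply] at h
        have hV : B.totalV t (m + 2) q = 0 := by
          rcases q with _ | q
          · rfl
          · exact (congrArg B.dv (hm (m + 2) q (by lia))).trans (map_zero _)
        rwa [hV, add_zero] at h)
      have hy0 : B.single m q y ∈ B.totalFil 0 (n - 1) := B.single_mem y (by lia) (by lia)
      obtain ⟨s, hs, hst⟩ := ih (t - B.totalD (B.single m q y)) (sub_mem ht (by
          have := B.total.d_mem hy0
          rwa [sub_add_cancel] at this))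
        (by rw [map_sub, totalD_totalD, sub_zero]; exact hdt)
        (by
          intro i j hi
          rw [totalD_single, Pi.sub_apply, Pi.sub_apply, Pi.add_apply, Pi.add_apply,
            B.single_of_ne (B.dv y) (by lia), add_zero]
          by_cases h : i = m + 1 ∧ j = q
          · obtain ⟨rfl, rfl⟩ := h
            rw [single_same, hy, sub_self]
          · rw [B.single_of_ne _ h, sub_zero]
            by_cases hi' : i = m + 1
            · exact ht i j (by subst hi'; push_cast; lia)
            · exact hm i j (by lia))
      refine ⟨s + B.single m q y, add_mem hs hy0, fun i j hi => ?_⟩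
      rw [map_add, add_comm, ← sub_sub]
      exact hst i j hi
    · refine ih t ht hdt fun i j hi => ?_
      exact ht i j (by lia)

section Edge

variable (L : CochainComplex (ModuleCat.{u} k) ℕ) (ε : ∀ n, L.X n →ₗ[k] B.X 0 n)
  (hinj : ∀ n, Function.Injective (ε n))
  (hd : ∀ n x, ε (n + 1) ((L.d n (n + 1)).hom x) = B.dv (ε n x))
  (hdh : ∀ n x, B.dh (ε n x) = 0) (hker : ∀ n y, B.dh y = 0 → ∃ x, ε n x = y)
  (hex : ∀ (p q : ℕ) (x : B.X (p + 1) q), B.dh x = 0 → ∃ y, B.dh y = x)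

include hd hdh in
theorem totalD_single_augmentation (n : ℕ) (x : L.X n) :
    B.totalD (B.single 0 n (ε n x)) = B.single 0 (n + 1) (ε (n + 1) ((L.d n (n + 1)).hom x)) := by
  rw [totalD_single, hdh, map_zero, zero_add, hd]

include hinj hd hdh hker hex in
/-- If the augmented rows `0 → L n → X 0 n → X 1 n → ⋯` of a bicomplex are exact, then the
cohomology of the total complex is the cohomology of `L`. -/
theorem exists_toHomology (n : ℕ) : ∃ ω : B.total.cyc n →ₗ[k] L.homology n,
    Function.Surjective ω ∧ ∀ x, ω x = 0 ↔ ∃ c ∈ B.total.fil 0 (n - 1), B.total.d c = x.1 := by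
  -- `θ` sends a cycle of `L` to the class of its image in the column `0`
  let bd : Submodule k (B.total.cyc n) :=
    ((B.total.fil 0 (n - 1)).map B.total.d).submoduleOf (B.total.cyc n)
  have hmem : ∀ x : L.cycleSubmodule n, B.single 0 n (ε n x.1) ∈ B.total.cyc n := fun x => by
    refine ⟨B.single_mem _ le_rfl (by simp), ?_⟩
    change B.totalD _ = 0
    rw [B.totalD_single_augmentation L ε hd hdh, x.2, map_zero, map_zero]
  let θ : L.cycleSubmodule n →ₗ[k] B.total.cyc n ⧸ bd := bd.mkQ ∘ₗ
    LinearMap.codRestrict _ (B.single 0 n ∘ₗ ε n ∘ₗ Submodule.subtype _) hmem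
  have hθ0 : ∀ x, θ x = 0 ↔ ∃ c ∈ B.totalFil 0 (n - 1), B.totalD c = B.single 0 n (ε n x.1) :=
    fun x => (Submodule.Quotient.mk_eq_zero bd)
  have hθ : Function.Surjective θ := by
    intro z
    obtain ⟨⟨t, ht, hdt⟩, rfl⟩ := Submodule.mkQ_surjective _ z
    replace hdt : B.totalD t = 0 := hdt
    obtain ⟨s, hs, hst⟩ := B.exists_sub_totalD hex n t ht
      (fun i j _ => by rw [hdt]; rfl) (fun i j hi => ht i j (by lia))
    have hmem' : t - B.totalD s ∈ B.totalFil 0 n := sub_mem ht (by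
      have := B.total.d_mem hs
      rwa [sub_add_cancel] at this)
    have heq := B.eq_single hmem' hst
    have hd0 : B.totalD (B.single 0 n ((t - B.totalD s) 0 n)) = 0 := by
      rw [← heq, map_sub, totalD_totalD, hdt, sub_zero]
    rw [totalD_single] at hd0
    obtain ⟨x, hx⟩ := hker n ((t - B.totalD s) 0 n) (by
      have := congrFun (congrFun hd0 1) n
      rw [Pi.add_apply, Pi.add_apply, B.single_of_ne (p := 0) (q := n + 1) _ (by lia),
        add_zero] at this
      exact (B.single_same _).symm.trans this)
    have hx0 : (L.d n (n + 1)).hom x = 0 := by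
      apply hinj
      rw [map_zero, hd, hx]
      have := congrFun (congrFun hd0 0) (n + 1)
      rw [Pi.add_apply, Pi.add_apply, B.single_of_ne (p := 0 + 1) (q := n) _ (by lia),
        zero_add] at this
      exact (B.single_same _).symm.trans this
    refine ⟨⟨x, fun j => ?_⟩, ?_⟩
    · by_cases hj : n + 1 = j
      · subst hj; exact hx0
      · rw [L.shape _ _ hj]; rfl
    · refine sub_eq_zero.1 ((map_sub bd.mkQ _ _).symm.trans
        ((Submodule.Quotient.mk_eq_zero bd).2 ?_))
      refine ⟨-s, neg_mem hs, ?_⟩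
      change B.totalD (-s) = B.single 0 n (ε n x) - t
      rw [hx, ← heq, map_neg]
      abel
  have hθL : ∀ x, L.homologyClass n x = 0 ↔ θ x = 0 := by
    intro x
    rw [hθ0, HomologicalComplex.homologyClass_eq_zero_iff]
    constructor
    · rintro ⟨j, y, hy⟩
      by_cases hj : j + 1 = n
      · subst hj
        refine ⟨B.single 0 j (ε j y), B.single_mem _ le_rfl (by push_cast; lia), ?_⟩
        rw [B.totalD_single_augmentation L ε hd hdh, hy]
      · rw [L.shape _ _ hj] at hy
        refine ⟨0, zero_mem _, ?_⟩
        rw [← hy, map_zero]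
        exact (map_zero (B.single 0 n ∘ₗ ε n)).symm
    · rintro ⟨c, hc, hcx⟩
      obtain ⟨s, hs, hst⟩ := B.exists_sub_totalD hex n c hc
        (fun i j hi => by rw [hcx]; exact B.single_of_ne _ (by lia))
        (fun i j hi => hc i j (by lia))
      rcases n with _ | m
      · refine ⟨0, 0, ?_⟩
        have hc0 : c = 0 := funext fun i => funext fun j => hc i j (by push_cast; lia)
        rw [map_zero]
        apply hinj
        rw [map_zero, ← B.single_same (p := 0) (q := 0) (ε 0 x.1), ← hcx, hc0, map_zero]
        rfl
      · have hn : (((m + 1 : ℕ) : ℤ) - 1) = m := by push_cast; lia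
        rw [hn] at hc hs
        have hmem' : c - B.totalD s ∈ B.totalFil 0 m := sub_mem hc (by
          have := B.total.d_mem hs
          rwa [sub_add_cancel] at this)
        have heq := B.eq_single hmem' hst
        have hd0 : B.totalD (B.single 0 m ((c - B.totalD s) 0 m)) =
            B.single 0 (m + 1) (ε (m + 1) x.1) := by
          rw [← heq, map_sub, totalD_totalD, hcx, sub_zero]
        rw [totalD_single] at hd0
        obtain ⟨y, hy⟩ := hker m ((c - B.totalD s) 0 m) (by
          have := congrFun (congrFun hd0 1) m
          rw [Pi.add_apply, Pi.add_apply, B.single_of_ne (p := 0) (q := m + 1) _ (by lia),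
            B.single_of_ne (p := 0) (q := m + 1) _ (by lia), add_zero] at this
          exact (B.single_same _).symm.trans this)
        refine ⟨m, y, hinj _ ?_⟩
        rw [hd, hy]
        have := congrFun (congrFun hd0 0) (m + 1)
        rw [Pi.add_apply, Pi.add_apply, B.single_of_ne (p := 0 + 1) (q := m) _ (by lia),
          zero_add, single_same, single_same] at this
        exact this
  let e := LinearMap.equivOfSurjective θ (L.homologyClass n) hθ (L.homologyClass_surjective n)
    fun x => (hθL x).symm
  refine ⟨e.toLinearMap ∘ₗ bd.mkQ, e.surjective.comp (Submodule.mkQ_surjective _), fun x => ?_⟩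
  exact (e.map_eq_zero_iff).trans (Submodule.Quotient.mk_eq_zero bd)

end Edge

end FirstQuadrantBicomplex

/-! ### The bicomplex of group cochains of a complex of representations -/

/-- A cochain complex of vector spaces with an action of a group by automorphisms of the complex. -/
structure EquivariantComplex (k G : Type u) [Field k] [Group G] where
  K : CochainComplex (ModuleCat.{u} k) ℕ
  act : G → (K ⟶ K)
  act_one : act 1 = 𝟙 K
  act_mul (s t : G) : act (s * t) = act t ≫ act s

theorem groupCohomology.d_comp_equivariant {k G : Type u} [Field k] [Group G] {A B : Rep.{u} k G}
    (φ : A →ₗ[k] B) (hφ : ∀ s a, φ (A.ρ s a) = B.ρ s (φ a)) (p : ℕ) (f : (Fin p → G) → A) :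
    (inhomogeneousCochains.d B p).hom (fun g => φ (f g)) =
      fun g => φ ((inhomogeneousCochains.d A p).hom f g) := by
  funext g
  simp [inhomogeneousCochains.d_hom_apply, hφ]

theorem groupCohomology.d_d_apply {k G : Type u} [Field k] [Group G] (A : Rep.{u} k G) (p : ℕ)
    (f : (Fin p → G) → A) :
    (inhomogeneousCochains.d A (p + 1)).hom ((inhomogeneousCochains.d A p).hom f) = 0 :=
  LinearMap.congr_fun (congrArg ModuleCat.Hom.hom (inhomogeneousCochains.d_comp_d p A)) f

theorem CochainComplex.mem_cycleSubmodule_iff {k : Type u} [Field k]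
    (K : CochainComplex (ModuleCat.{u} k) ℕ) {q : ℕ} {x : K.X q} :
    x ∈ K.cycleSubmodule q ↔ (K.d q (q + 1)).hom x = 0 := by
  refine ⟨fun h => h _, fun h j => ?_⟩
  by_cases hj : q + 1 = j
  · subst hj; exact h
  · rw [K.shape _ _ hj]; rfl

namespace EquivariantComplex

variable {k G : Type u} [Field k] [Group G] (A : EquivariantComplex k G)

/-- The representation of `G` on the degree `q` part of the complex. -/
def rep (q : ℕ) : Rep.{u} k G :=
  Rep.of (X := A.K.X q)
    { toFun := fun s => ((A.act s).f q).hom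
      map_one' := by rw [A.act_one]; rfl
      map_mul' := fun s t => by rw [A.act_mul]; rfl }

/-- The differential of the complex, as a map of representations. -/
def d (q : ℕ) : A.rep q →ₗ[k] A.rep (q + 1) := (A.K.d q (q + 1)).hom

theorem d_rho (q : ℕ) (s : G) (x : A.rep q) :
    A.d q ((A.rep q).ρ s x) = (A.rep (q + 1)).ρ s (A.d q x) :=
  (LinearMap.congr_fun (congrArg ModuleCat.Hom.hom ((A.act s).comm q (q + 1))) x)

theorem d_d (q : ℕ) (x : A.rep q) : A.d (q + 1) (A.d q x) = 0 :=
  LinearMap.congr_fun (congrArg ModuleCat.Hom.hom (A.K.d_comp_d q (q + 1) (q + 1 + 1))) x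

/-- The cycles of degree `q`. -/
def cyc (q : ℕ) : Submodule k (A.rep q) := A.K.cycleSubmodule q

theorem mem_cyc {q : ℕ} {x : A.rep q} : x ∈ A.cyc q ↔ A.d q x = 0 :=
  CochainComplex.mem_cycleSubmodule_iff A.K

theorem rho_mem_cyc (q : ℕ) (s : G) {x : A.rep q} (hx : x ∈ A.cyc q) :
    (A.rep q).ρ s x ∈ A.cyc q := by
  rw [mem_cyc] at hx ⊢
  rw [d_rho, hx, map_zero]

/-- The representation of `G` on the cycles of degree `q`. -/
def cycleRep (q : ℕ) : Rep.{u} k G :=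
  Rep.of (X := A.cyc q)
    { toFun := fun s => ((A.rep q).ρ s).restrict fun _ hx => A.rho_mem_cyc q s hx
      map_one' := LinearMap.ext fun x => Subtype.ext
        (LinearMap.congr_fun (map_one (A.rep q).ρ) x.1)
      map_mul' := fun s t => LinearMap.ext fun x => Subtype.ext
        (LinearMap.congr_fun (map_mul (A.rep q).ρ s t) x.1) }

/-- The representation of `G` on the cohomology in degree `q`. -/
def homologyRep (q : ℕ) : Rep.{u} k G :=
  Rep.of (X := A.K.homology q)
    { toFun := fun s => (HomologicalComplex.homologyMap (A.act s) q).hom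
      map_one' := by rw [A.act_one, HomologicalComplex.homologyMap_id]; rfl
      map_mul' := fun s t => by rw [A.act_mul, HomologicalComplex.homologyMap_comp]; rfl }

/-- The inclusion of the cycles, as a map of representations. -/
def incl (q : ℕ) : A.cycleRep q →ₗ[k] A.rep q := (A.cyc q).subtype

/-- The projection from the cycles to the cohomology, as a map of representations. -/
def proj (q : ℕ) : A.cycleRep q →ₗ[k] A.homologyRep q := A.K.homologyClass q

theorem proj_zero_eq_zero_iff (x : A.cycleRep 0) : A.proj 0 x = 0 ↔ A.incl 0 x = 0 := by
  refine (A.K.homologyClass_eq_zero_iff 0 x).trans ⟨?_, fun h => ⟨0, 0, ?_⟩⟩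
  · rintro ⟨j, y, hy⟩
    rw [A.K.shape j 0 (by simp)] at hy
    exact hy.symm
  · exact (map_zero _).trans h.symm

theorem proj_succ_eq_zero_iff {q : ℕ} (x : A.cycleRep (q + 1)) :
    A.proj (q + 1) x = 0 ↔ ∃ y, A.d q y = A.incl (q + 1) x := by
  refine (A.K.homologyClass_eq_zero_iff (q + 1) x).trans ⟨?_, fun ⟨y, hy⟩ => ⟨q, y, hy⟩⟩
  rintro ⟨j, y, hy⟩
  by_cases hj : j = q
  · subst hj; exact ⟨y, hy⟩
  · rw [A.K.shape j (q + 1) (by simpa using hj)] at hy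
    exact ⟨0, (map_zero _).trans hy⟩

theorem incl_rho (q : ℕ) (s : G) (x : A.cycleRep q) :
    A.incl q ((A.cycleRep q).ρ s x) = (A.rep q).ρ s (A.incl q x) := rfl

theorem proj_rho (q : ℕ) (s : G) (x : A.cycleRep q) :
    A.proj q ((A.cycleRep q).ρ s x) = (A.homologyRep q).ρ s (A.proj q x) :=
  (HomologicalComplex.homologyMap_homologyClass (A.act s) q x
    (A.rho_mem_cyc q s x.2)).symm

theorem proj_surjective (q : ℕ) : Function.Surjective (A.proj q) :=
  A.K.homologyClass_surjective q

/-- The bicomplex with terms `C^p(G, K^q)`. The sign makes the differentials anticommute. -/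
def bicomplex : FirstQuadrantBicomplex k where
  X p q := (Fin p → G) → A.rep q
  dh {p q} := (inhomogeneousCochains.d (A.rep q) p).hom
  dv {p q} := (-1 : k) ^ p • (A.d q).compLeft (Fin p → G)
  dh_dh x := groupCohomology.d_d_apply _ _ x
  dv_dv {p q} x := by
    funext g
    change (-1 : k) ^ p • A.d (q + 1) ((-1 : k) ^ p • A.d q (x g)) = 0
    rw [map_smul, d_d, smul_zero, smul_zero]
  dh_dv_add_dv_dh {p q} x := by
    have h := groupCohomology.d_comp_equivariant (A := A.rep q) (B := A.rep (q + 1))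
      (A.d q) (A.d_rho q) p x
    change (inhomogeneousCochains.d (A.rep (q + 1)) p).hom ((-1 : k) ^ p • fun g => A.d q (x g)) +
      (-1 : k) ^ (p + 1) • (fun g => A.d q ((inhomogeneousCochains.d (A.rep q) p).hom x g)) = 0
    rw [← h, map_smul, pow_succ, mul_neg_one, neg_smul, add_neg_cancel]

theorem dv_apply {p q : ℕ} (x : A.bicomplex.X p q) (g : Fin p → G) :
    A.bicomplex.dv x g = (-1 : k) ^ p • A.d q (x g) := rfl

theorem dv_eq_zero_iff {p q : ℕ} (x : A.bicomplex.X p q) :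
    A.bicomplex.dv x = 0 ↔ ∀ g, x g ∈ A.cyc q := by
  refine funext_iff.trans (forall_congr' fun g => ?_)
  rw [mem_cyc, dv_apply]
  exact smul_eq_zero_iff_right (pow_ne_zero _ (by simp))

/-- A cochain with values in the cycles is a vertical boundary if its values have zero cohomology
class. -/
theorem exists_totalV {p q : ℕ} (z : (Fin p → G) → A.cycleRep q) (h : ∀ g, A.proj q (z g) = 0) :
    ∃ e ∈ A.bicomplex.totalFil p (p + q - 1),
      A.bicomplex.totalV e p q = fun g => A.incl q (z g) := by
  rcases q with _ | q
  · exact ⟨0, zero_mem _, funext fun g => ((A.proj_zero_eq_zero_iff _).1 (h g)).symm⟩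
  · choose y hy using fun g => (A.proj_succ_eq_zero_iff _).1 (h g)
    let y' : A.bicomplex.X p q := fun g => (-1 : k) ^ p • y g
    refine ⟨A.bicomplex.single p q y', A.bicomplex.single_mem _ le_rfl (by push_cast; lia), ?_⟩
    funext g
    change A.bicomplex.dv (A.bicomplex.single p q y' p q) g = _
    rw [A.bicomplex.single_same, dv_apply]
    change (-1 : k) ^ p • A.d q ((-1 : k) ^ p • y g) = _
    rw [map_smul, smul_smul, ← mul_pow, hy]
    simp

/-- A cochain with values in the cycles has zero cohomology classes if it is a vertical
boundary. -/
theorem proj_eq_zero {p q : ℕ} {e : A.bicomplex.Total} (z : (Fin p → G) → A.cycleRep q)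
    (hz : A.bicomplex.totalV e p q = fun g => A.incl q (z g)) (g : Fin p → G) :
    A.proj q (z g) = 0 := by
  rcases q with _ | q
  · exact (A.proj_zero_eq_zero_iff _).2 (congrFun hz g).symm
  · refine (A.proj_succ_eq_zero_iff _).2 ⟨(-1 : k) ^ p • (show A.rep q from e p q g), ?_⟩
    rw [map_smul]
    exact congrFun hz g

/-- The term of `a ∈ Z₂` in its lowest column has values in the cycles. -/
theorem lowest_mem {p q : ℕ} {a : A.bicomplex.Total} {r : ℤ} (hr : 1 ≤ r)
    (ha : a ∈ A.bicomplex.total.Z r p (p + q)) (g : Fin p → G) :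
    a p q g ∈ A.cyc q := by
  refine (A.dv_eq_zero_iff (a p q)).1 ?_ g
  have h := ha.2 p (q + 1) (by lia)
  change A.bicomplex.totalH a p (q + 1) + A.bicomplex.dv (a p q) = 0 at h
  rwa [A.bicomplex.totalH_eq_zero ha.1 le_rfl, zero_add] at h

/-- The term of `a ∈ Z_r` in its lowest column, as a group cochain with values in the cycles. -/
def lowest {r : ℤ} (hr : 1 ≤ r) (p q : ℕ) :
    A.bicomplex.total.Z r p (p + q) →ₗ[k] ((Fin p → G) → A.cycleRep q) where
  toFun a g := ⟨a.1 p q g, A.lowest_mem hr a.2 g⟩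
  map_add' _ _ := rfl
  map_smul' _ _ := rfl

theorem d_proj {p q : ℕ} (z : (Fin p → G) → A.cycleRep q) :
    (inhomogeneousCochains.d (A.homologyRep q) p).hom (fun g => A.proj q (z g)) =
      fun g => A.proj q ((inhomogeneousCochains.d (A.cycleRep q) p).hom z g) :=
  groupCohomology.d_comp_equivariant (A.proj q) (A.proj_rho q) p z

theorem dh_incl {p q : ℕ} (z : (Fin p → G) → A.cycleRep q) :
    A.bicomplex.dh (p := p) (q := q) (fun g => A.incl q (z g)) =
      fun g => A.incl q ((inhomogeneousCochains.d (A.cycleRep q) p).hom z g) :=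
  groupCohomology.d_comp_equivariant (A.incl q) (A.incl_rho q) p z

theorem cochains_d (V : Rep.{u} k G) (p : ℕ) (f : (Fin p → G) → V) :
    ((groupCohomology.inhomogeneousCochains V).d p (p + 1)).hom f =
      (inhomogeneousCochains.d V p).hom f := by
  rw [groupCohomology.inhomogeneousCochains.d_def]

theorem lowest_mem_cycleSubmodule {p q : ℕ} (a : A.bicomplex.total.Z 2 p (p + q)) :
    (fun g => A.proj q (A.lowest one_le_two p q a g)) ∈
      (groupCohomology.inhomogeneousCochains (A.homologyRep q)).cycleSubmodule p := by
  rw [CochainComplex.mem_cycleSubmodule_iff]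
  refine (cochains_d _ _ _).trans ?_
  rw [d_proj]
  funext g
  have h := a.2.2 (p + 1) q (by push_cast; lia)
  change A.bicomplex.dh (a.1 p q) + A.bicomplex.totalV a.1 (p + 1) q = 0 at h
  refine A.proj_eq_zero (e := -a.1) _ ?_ g
  rw [← dh_incl]
  refine Eq.trans ?_ (neg_eq_of_add_eq_zero_left h)
  rcases q with _ | q
  · exact neg_zero.symm
  · exact map_neg A.bicomplex.dv _

/-- The map sending an element of `Z₂` to the class in `H^p(G, H^q(K))` of its term in the lowest
column. -/
def toGroupCohomology (p q : ℕ) :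
    A.bicomplex.total.Z 2 p (p + q) →ₗ[k] groupCohomology (A.homologyRep q) p :=
  (groupCohomology.inhomogeneousCochains (A.homologyRep q)).homologyClass p ∘ₗ
    LinearMap.codRestrict _ ((A.proj q).compLeft (Fin p → G) ∘ₗ A.lowest one_le_two p q)
      A.lowest_mem_cycleSubmodule

theorem toGroupCohomology_surjective (p q : ℕ) :
    Function.Surjective (A.toGroupCohomology p q) := by
  intro h
  obtain ⟨⟨β, hβ⟩, rfl⟩ := HomologicalComplex.homologyClass_surjective
    (groupCohomology.inhomogeneousCochains (A.homologyRep q)) p h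
  rw [CochainComplex.mem_cycleSubmodule_iff] at hβ
  choose z hz using fun g => A.proj_surjective q (β g)
  obtain rfl : (fun g => A.proj q (z g)) = β := funext hz
  replace hβ := (cochains_d _ _ _).symm.trans hβ
  rw [d_proj] at hβ
  obtain ⟨e, he, hez⟩ := A.exists_totalV _ (congrFun hβ)
  rw [← dh_incl] at hez
  let y : A.bicomplex.X p q := fun g => A.incl q (z g)
  have hy : A.bicomplex.dv y = 0 := (A.dv_eq_zero_iff y).2 fun g => (z g).2
  have hep : e p q = 0 := he p q (by push_cast; lia)
  have he' : e ∈ A.bicomplex.totalFil (p + 1) (p + q) := by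
    refine A.bicomplex.total.mem_fil_of_eq he ?_ ?_ <;> push_cast <;> lia
  have hmem : A.bicomplex.single p q y - e ∈ A.bicomplex.total.Z 2 p (p + q) := by
    refine A.bicomplex.total.mem_Z.2 ⟨sub_mem (A.bicomplex.single_mem y le_rfl rfl)
      (A.bicomplex.total.anti (by lia) he'), ?_⟩
    change A.bicomplex.totalD _ ∈ A.bicomplex.totalFil (p + 2) (p + q + 1)
    have h1 : A.bicomplex.totalD (A.bicomplex.single p q y - e) ∈
        A.bicomplex.totalFil ((p + 1 : ℕ) : ℤ) (p + q + 1) := by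
      rw [map_sub, A.bicomplex.totalD_single, hy, map_zero, add_zero]
      exact sub_mem (A.bicomplex.single_mem _ le_rfl (by push_cast; lia))
        (A.bicomplex.total.mem_fil_of_eq (A.bicomplex.total.d_mem he'))
    have h2 := A.bicomplex.mem_totalFil_succ (p := p + 1) (q := q) (by push_cast; lia) h1 ?_
    · exact A.bicomplex.total.mem_fil_of_eq h2
    · rw [map_sub, A.bicomplex.totalD_single, hy, map_zero, add_zero, Pi.sub_apply, Pi.sub_apply,
        A.bicomplex.single_same, A.bicomplex.totalD_apply,
        A.bicomplex.totalH_eq_zero he le_rfl, zero_add, hez]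
      exact sub_self _
  refine ⟨⟨_, hmem⟩, congrArg (HomologicalComplex.homologyClass _ p) (Subtype.ext ?_)⟩
  funext g
  refine congrArg (A.proj q) (Subtype.ext ?_)
  change (A.bicomplex.single p q y p q - e p q) g = y g
  rw [hep, sub_zero, A.bicomplex.single_same]

theorem toGroupCohomology_eq_zero_iff (p q : ℕ) (a : A.bicomplex.total.Z 2 p (p + q)) :
    A.toGroupCohomology p q a = 0 ↔ a.1 ∈ A.bicomplex.total.D 2 p (p + q) := by
  constructor
  · intro h
    obtain ⟨i, β, hβ⟩ := ((groupCohomology.inhomogeneousCochains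
      (A.homologyRep q)).homologyClass_eq_zero_iff p _).1 h
    -- `c₁` lifts the cochain with coboundary the class of the lowest term of `a`
    obtain ⟨c₁, hc₁, hac₁⟩ : ∃ c ∈ A.bicomplex.total.Z 1 (p - 1) (p + q - 1),
        ∃ w : (Fin p → G) → A.cycleRep q, (A.bicomplex.totalD c p q = fun g => A.incl q (w g)) ∧
          ∀ g, A.proj q (A.lowest one_le_two p q a g) = A.proj q (w g) := by
      by_cases hi : i + 1 = p
      · subst hi
        choose z hz using fun g => A.proj_surjective q (β g)
        obtain rfl : (fun g => A.proj q (z g)) = β := funext hz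
        replace hβ := (cochains_d _ _ _).symm.trans hβ
        rw [d_proj] at hβ
        let y : A.bicomplex.X i q := fun g => A.incl q (z g)
        have hy : A.bicomplex.dv y = 0 := (A.dv_eq_zero_iff y).2 fun g => (z g).2
        have hDy : A.bicomplex.totalD (A.bicomplex.single i q y) =
            A.bicomplex.single (i + 1) q (A.bicomplex.dh y) := by
          rw [A.bicomplex.totalD_single, hy, map_zero, add_zero]
        refine ⟨A.bicomplex.single i q y, A.bicomplex.total.mem_Z.2
          ⟨A.bicomplex.single_mem y (by push_cast; lia) (by push_cast; lia), ?_⟩,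
          (inhomogeneousCochains.d (A.cycleRep q) i).hom z, ?_, ?_⟩
        · change A.bicomplex.totalD _ ∈ A.bicomplex.totalFil _ _
          rw [hDy]
          exact A.bicomplex.single_mem _ (by push_cast; lia) (by push_cast; lia)
        · rw [hDy, A.bicomplex.single_same]
          exact A.dh_incl z
        · exact fun g => (congrFun hβ g).symm
      · rw [(groupCohomology.inhomogeneousCochains (A.homologyRep q)).shape i p hi] at hβ
        refine ⟨0, zero_mem _, 0, ?_, fun g => ?_⟩
        · rw [map_zero]
          exact funext fun g => (map_zero (A.incl q)).symm
        · exact (congrFun hβ g).symm.trans (map_zero (A.proj q)).symm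
    obtain ⟨w, hw, hproj⟩ := hac₁
    obtain ⟨e, he, hez⟩ := A.exists_totalV (fun g => A.lowest one_le_two p q a g - w g)
      fun g => by rw [map_sub, hproj, sub_self]
    have hc : c₁ + e ∈ A.bicomplex.total.Z 1 (p - 1) (p + q - 1) := by
      refine add_mem hc₁ (A.bicomplex.total.mem_Z.2
        ⟨A.bicomplex.total.mem_fil_of_eq he, ?_⟩)
      exact A.bicomplex.total.mem_fil_of_eq (A.bicomplex.total.d_mem he)
    refine A.bicomplex.total.mem_D.2 ⟨a.1 - A.bicomplex.totalD (c₁ + e),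
      A.bicomplex.total.mem_Z.2 ⟨?_, ?_⟩, c₁ + e, A.bicomplex.total.mem_Z_of_eq hc,
      sub_add_cancel _ _⟩
    · refine A.bicomplex.mem_totalFil_succ rfl (sub_mem a.2.1
        (A.bicomplex.total.mem_fil_of_eq (A.bicomplex.total.mem_Z.1 hc).2)) ?_
      rw [map_add, Pi.sub_apply, Pi.sub_apply, Pi.add_apply, Pi.add_apply, hw,
        A.bicomplex.totalD_apply e, A.bicomplex.totalH_eq_zero he le_rfl, zero_add, hez]
      funext g
      change a.1 p q g - (A.incl q (w g) +
        A.incl q (A.lowest one_le_two p q a g - w g)) = 0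
      rw [map_sub, add_sub_cancel]
      exact sub_self _
    · change A.bicomplex.totalD _ ∈ A.bicomplex.totalFil _ _
      rw [map_sub, A.bicomplex.totalD_totalD, sub_zero]
      exact A.bicomplex.total.mem_fil_of_eq a.2.2
  · intro h
    obtain ⟨b, hb, c, hc, hbc⟩ := A.bicomplex.total.mem_D.1 h
    replace hc : c ∈ A.bicomplex.total.Z 1 (p - 1) (p + q - 1) := A.bicomplex.total.mem_Z_of_eq hc
    have hap : a.1 p q = A.bicomplex.totalH c p q + A.bicomplex.totalV c p q := by
      rw [← hbc]
      change b p q + A.bicomplex.totalD c p q = _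
      rw [hb.1 p q (by lia), zero_add]
      rfl
    refine (HomologicalComplex.homologyClass_eq_zero_iff _ p _).2 ?_
    rcases p with _ | p
    · refine ⟨0, 0, (map_zero _).trans (funext fun g => ?_)⟩
      refine (A.proj_eq_zero (e := c) (A.lowest one_le_two 0 q a) ?_ g).symm
      exact (hap.trans (zero_add _)).symm
    · have hcm : c ∈ A.bicomplex.total.Z 1 p (p + q) := by
        refine A.bicomplex.total.mem_Z_of_eq hc rfl ?_ ?_ <;> push_cast <;> lia
      refine ⟨p, fun g => A.proj q (A.lowest le_rfl p q ⟨c, hcm⟩ g), ?_⟩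
      refine (cochains_d _ _ _).trans ?_
      rw [d_proj]
      funext g
      refine (sub_eq_zero.1 ?_).symm
      change A.proj q _ - A.proj q _ = 0
      rw [← map_sub]
      refine A.proj_eq_zero (e := c) (fun g => A.lowest one_le_two (p + 1) q a g -
        (inhomogeneousCochains.d (A.cycleRep q) p).hom (A.lowest le_rfl p q ⟨c, hcm⟩) g) ?_ g
      have h1 := A.dh_incl (A.lowest le_rfl p q ⟨c, hcm⟩)
      funext g
      rw [map_sub]
      rw [← congrFun h1 g]
      refine eq_sub_of_add_eq' ?_
      exact (congrFun hap g).symm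

/-- The second page of the spectral sequence of the bicomplex `C^p(G, K^q)`. -/
def pageTwoIso (p q : ℕ) :
    (A.bicomplex.total.spectralSequence.page 2 le_rfl).X (p, q) ≅
      groupCohomology (A.homologyRep q) p :=
  LinearEquiv.toModuleIso (LinearMap.quotEquivOfSurjective (A.toGroupCohomology p q)
    (A.toGroupCohomology_surjective p q) ((A.bicomplex.total.D 2 p (p + q)).submoduleOf _)
    (A.toGroupCohomology_eq_zero_iff p q))

end EquivariantComplex

/-! ### Acyclicity of products over free `G`-sets -/

theorem Fin.contractNth_zero_cons {G : Type*} [Mul G] {p : ℕ} (a : G) (g : Fin (p + 1) → G) :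
    Fin.contractNth (0 : Fin (p + 2)) (· * ·) (Fin.cons a g : Fin (p + 2) → G) =
      (Fin.cons (a * g 0) (fun i => g i.succ) : Fin (p + 1) → G) := by
  funext i
  refine Fin.cases ?_ (fun i => ?_) i
  · simp [Fin.contractNth]
  · simp [Fin.contractNth]

theorem Fin.contractNth_succ_cons {G : Type*} [Mul G] {p : ℕ} (a : G) (g : Fin (p + 1) → G)
    (j : Fin (p + 1)) :
    Fin.contractNth j.succ (· * ·) (Fin.cons a g : Fin (p + 2) → G) =
      (Fin.cons a (Fin.contractNth j (· * ·) g) : Fin (p + 1) → G) := by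
  funext i
  refine Fin.cases ?_ (fun i => ?_) i
  · simp [Fin.contractNth]
  · simp [Fin.contractNth]

theorem groupCohomology.d_zero_apply {k G : Type u} [Field k] [Group G] (V : Rep.{u} k G)
    (f : (Fin 0 → G) → V) (g : Fin 1 → G) :
    (inhomogeneousCochains.d V 0).hom f g = V.ρ (g 0) (f default) - f default := by
  rw [inhomogeneousCochains.d_hom_apply]
  simp [sub_eq_add_neg, Subsingleton.elim _ (default : Fin 0 → G)]

/-- Let `Δ` be a diagonal operator on families of elements of a representation `V` which are
indexed by a `G`-set `X`, and suppose that there is an equivariant map `τ : X → G`. (The example is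
a product of spaces indexed by `X`, where `Δ` picks the component at `x` of the member `x` of the
family.) Then `V` has no group cohomology in positive degrees: the operator
`(h φ) (g) = Δ (x ↦ τ(x) φ (τ(x)⁻¹, g))` is a contracting homotopy. -/
theorem groupCohomology.exists_d_eq_of_diagonal {k G X : Type u} [Field k] [Group G]
    [MulAction G X] (V : Rep.{u} k G) (τ : X → G) (hτ : ∀ (s : G) x, τ (s • x) = s * τ x)
    (Δ : (X → V) →ₗ[k] V) (hΔ : ∀ (s : G) a, V.ρ s (Δ a) = Δ fun x => V.ρ s (a (s⁻¹ • x)))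
    (hc : ∀ v, Δ (fun _ => v) = v) (p : ℕ) (φ : (Fin (p + 1) → G) → V)
    (hφ : (inhomogeneousCochains.d V (p + 1)).hom φ = 0) :
    ∃ ψ, (inhomogeneousCochains.d V p).hom ψ = φ := by
  refine ⟨fun g => Δ fun x => V.ρ (τ x) (φ (Fin.cons (τ x)⁻¹ g)), funext fun g => ?_⟩
  have hρ : ∀ s v, V.ρ s (V.ρ s⁻¹ v) = v := fun s v => by simp
  have key : ∀ x, φ g = V.ρ (τ x) (φ (Fin.cons ((τ x)⁻¹ * g 0) fun i => g i.succ)) +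
      ∑ j : Fin (p + 1), (-1 : k) ^ ((j : ℕ) + 1) •
        V.ρ (τ x) (φ (Fin.cons (τ x)⁻¹ (Fin.contractNth j (· * ·) g))) := by
    intro x
    have h := congrFun hφ (Fin.cons (τ x)⁻¹ g)
    rw [inhomogeneousCochains.d_hom_apply, Fin.sum_univ_succ] at h
    simp only [Fin.cons_zero, Fin.cons_succ, Fin.contractNth_zero_cons, Fin.contractNth_succ_cons,
      Fin.val_zero, Fin.val_succ] at h
    have h' := congrArg (V.ρ (τ x)) h
    simp only [map_add, map_sum, map_smul, hρ] at h'
    rw [Pi.zero_apply, map_zero, add_eq_zero_iff_eq_neg] at h'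
    rw [h', neg_add, ← Finset.sum_neg_distrib]
    congr 1
    · simp
    · refine Finset.sum_congr rfl fun j _ => ?_
      rw [pow_succ _ ((j : ℕ) + 1), mul_neg_one, neg_smul, neg_neg]
  rw [inhomogeneousCochains.d_hom_apply, hΔ]
  have h0 : (fun x => V.ρ (g 0) (V.ρ (τ ((g 0)⁻¹ • x))
      (φ (Fin.cons (τ ((g 0)⁻¹ • x))⁻¹ fun i => g i.succ)))) =
      fun x => V.ρ (τ x) (φ (Fin.cons ((τ x)⁻¹ * g 0) fun i => g i.succ)) := by
    funext x
    rw [hτ, map_mul, mul_inv_rev, inv_inv, Module.End.mul_apply, hρ]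
  rw [h0]
  simp only [← map_smul, ← map_sum, ← map_add]
  refine Eq.trans (congrArg Δ (funext fun x => ?_)) (hc (φ g))
  rw [Pi.add_apply, Finset.sum_apply, key x]
  rfl

namespace EquivariantComplex

variable {k G : Type u} [Field k] [Group G] (A : EquivariantComplex k G)

/-- If the representations `K^q` have no group cohomology in positive degrees and if `L` is the
complex of the invariants of `K`, then the spectral sequence of the bicomplex `C^p(G, K^q)`
converges to the cohomology of `L`. -/
theorem exists_spectralSequence (L : CochainComplex (ModuleCat.{u} k) ℕ) (ι : L ⟶ A.K)
    (hinj : ∀ n, Function.Injective (ι.f n).hom)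
    (hrange : ∀ n (y : A.rep n), (∀ s, (A.rep n).ρ s y = y) ↔ ∃ x, (ι.f n).hom x = y)
    (hex : ∀ p q (φ : (Fin (p + 1) → G) → A.rep q),
      (inhomogeneousCochains.d (A.rep q) (p + 1)).hom φ = 0 →
        ∃ ψ, (inhomogeneousCochains.d (A.rep q) p).hom ψ = φ) :
    ∃ E : E₂CohomologicalSpectralSequenceNat (ModuleCat.{u} k),
      (∀ p q : ℕ, Nonempty ((E.page 2 le_rfl).X (p, q) ≅ groupCohomology (A.homologyRep q) p)) ∧
      E.ConvergesTo (fun n => L.homology n) := by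
  let ε : ∀ n, L.X n →ₗ[k] A.bicomplex.X 0 n := fun n => LinearMap.pi fun _ => (ι.f n).hom
  have hdh : ∀ n (y : (Fin 0 → G) → A.rep n), A.bicomplex.dh (p := 0) (q := n) y = 0 ↔
      ∀ s, (A.rep n).ρ s (y default) = y default := fun n y => by
    constructor
    · intro h s
      have := congrFun h fun _ => s
      exact sub_eq_zero.1 ((groupCohomology.d_zero_apply (A.rep n) y fun _ => s).symm.trans this)
    · intro h
      funext g
      exact (groupCohomology.d_zero_apply (A.rep n) y g).trans (sub_eq_zero.2 (h _))
  choose ω hω hker using fun n => A.bicomplex.exists_toHomology L ε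
    (fun n x y h => hinj n (congrFun h default))
    (fun n x => funext fun g => by
      rw [dv_apply, pow_zero, one_smul]
      exact (LinearMap.congr_fun (congrArg ModuleCat.Hom.hom (ι.comm n (n + 1))) x).symm)
    (fun n x => (hdh n _).2 ((hrange n _).2 ⟨x, rfl⟩))
    (fun n y hy => by
      obtain ⟨x, hx⟩ := (hrange n _).1 ((hdh n y).1 hy)
      refine ⟨x, funext fun g => ?_⟩
      rw [Subsingleton.elim g default]
      exact hx)
    (fun p q => hex p q) n
  exact ⟨A.bicomplex.total.spectralSequence, fun p q => ⟨A.pageTwoIso p q⟩,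
    A.bicomplex.total.convergesTo _ ω hω hker⟩

end EquivariantComplex

/-! ### Morphisms of the base of a Galois covering -/

namespace OrbitCategory

open LinearGroupAction

variable {k G C : Type u} [Field k] [Group G] [SmallCategory C] [Preadditive C]
  [Linear k C] [MulAction G C] [LinearGroupAction k G C] [FreeOnObjects G C]

/-- A linear map on the morphisms of `C/G` from the orbit of `x` to `v` is determined freely by its
values on the classes of the morphisms of `C` with source `x`. -/
theorem exists_lift_of_source {u v : OrbitCategory k G C} (x : C) (hx : mk k G x = u) {N : Type u}
    [AddCommGroup N] [Module k N] (ψ : ∀ y (_ : mk k G y = v), (x ⟶ y) →ₗ[k] N) :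
    ∃ φ : Hom u v →ₗ[k] N, ∀ y (hy : mk k G y = v) (c : x ⟶ y), φ (cls hx hy c) = ψ y hy c := by
  have hψ : ∀ (y y' : C) (h : y = y') (hy : mk k G y = v) (c : x ⟶ y),
      ψ y hy c = ψ y' (h ▸ hy) (c ≫ eqToHom h) := by
    rintro y _ rfl hy c
    simp
  -- the value at a morphism `c` with source in the orbit of `x`, which `s` translates to the
  -- source `x`
  let aux : ∀ (x' y' : C) (_ : mk k G y' = v) (s : G) (_ : s • x' = x), (x' ⟶ y') →ₗ[k] N :=
    fun x' y' hy' s hs =>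
      { toFun := fun c => ψ (s • y') ((mk_smul k G s y').trans hy')
          (eqToHom hs.symm ≫ hom (k := k) s c)
        map_add' := by intros; simp
        map_smul' := by intros; simp }
  have haux : ∀ (x' y' : C) (hy' : mk k G y' = v) (s t : G) (hs : s • x' = x) (ht : t • x' = x)
      (c : x' ⟶ y'), aux x' y' hy' s hs c = aux x' y' hy' t ht c := by
    intro x' y' hy' s t hs ht c
    obtain rfl : s = t := smul_left_injective (hs.trans ht.symm)
    rfl
  refine ⟨homLift (fun x' y' hx' hy' => aux x' y' hy' (shift hx hx') (shift_smul hx hx')) ?_, ?_⟩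
  · intro t x' y' hx' hy' c
    have hs := shift_smul hx hx'
    have ht : (shift hx hx' * t⁻¹) • t • x' = x := by rw [mul_smul, inv_smul_smul, hs]
    rw [haux _ _ ((mk_smul k G t y').trans hy') _ _
      (shift_smul hx ((mk_smul k G t x').trans hx')) ht]
    have e : (shift hx hx' * t⁻¹) • t • y' = shift hx hx' • y' := by
      rw [mul_smul, inv_smul_smul]
    refine (hψ _ _ e _ _).trans ?_
    change ψ _ _ _ = ψ _ _ _
    congr 1
    rw [mul_hom, hom_inv_hom, hom_eqToHom_comp, hom_comp_eqToHom]
    simp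
  · intro y hy c
    rw [homLift_cls, haux _ _ hy _ 1 (shift_smul hx hx) (one_smul G x)]
    refine (hψ _ _ (one_smul G y) _ _).trans ?_
    congr 1
    rw [one_hom]
    simp

theorem hom_ext_of_source {u v : OrbitCategory k G C} (x : C) (hx : mk k G x = u) {N : Type u}
    [AddCommGroup N] [Module k N] {φ φ' : Hom u v →ₗ[k] N}
    (h : ∀ y (hy : mk k G y = v) (c : x ⟶ y), φ (cls hx hy c) = φ' (cls hx hy c)) : φ = φ' := by
  refine LinearMap.ext fun f => ?_
  refine hom_induction (P := fun f => φ f = φ' f) x hx ?_ ?_ h f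
  · rw [map_zero, map_zero]
  · intro f g hf hg
    rw [map_add, map_add, hf, hg]

end OrbitCategory

namespace IsGaloisCovering

variable {k G C B : Type u} [Field k] [Group G] [SmallCategory C]
    [Preadditive C] [Linear k C] [MulAction G C] [LinearGroupAction k G C] [FreeOnObjects G C]
    [SmallCategory B] [Preadditive B] [Linear k B] {F : C ⥤ B}

theorem surjective_obj (hF : IsGaloisCovering k G F) : Function.Surjective F.obj := by
  obtain ⟨E, -, -, -, -, hE, rfl⟩ := hF
  intro b
  obtain ⟨u, rfl⟩ := hE.2 b
  obtain ⟨x, rfl⟩ := OrbitCategory.exists_rep k G u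
  exact ⟨x, rfl⟩

/-- The group acts transitively on the objects over a given object of the base. -/
theorem exists_smul_eq (hF : IsGaloisCovering k G F) {x y : C} (h : F.obj x = F.obj y) :
    ∃ s : G, s • y = x := by
  obtain ⟨E, -, -, -, -, hE, rfl⟩ := hF
  exact (OrbitCategory.mk_eq_iff k G).1 (hE.1 h)

variable (k F) in
/-- The image in `B` of a morphism of `C`, with source and target identified with given objects. -/
def mapHom [F.Additive] [F.Linear k] {x y : C} {u v : B} (hx : F.obj x = u) (hy : F.obj y = v) :
    (x ⟶ y) →ₗ[k] (u ⟶ v) where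
  toFun c := eqToHom hx.symm ≫ F.map c ≫ eqToHom hy
  map_add' := by intros; simp
  map_smul' := by intros; simp

variable [F.Additive] [F.Linear k]

theorem mapHom_apply {x y : C} {u v : B} (hx : F.obj x = u) (hy : F.obj y = v) (c : x ⟶ y) :
    mapHom k F hx hy c = eqToHom hx.symm ≫ F.map c ≫ eqToHom hy := rfl

theorem mapHom_rfl {x y : C} (c : x ⟶ y) : mapHom k F rfl rfl c = F.map c := by
  simp [mapHom_apply]

/-- Restricting a linear map along the morphisms with a given source `x` identifies linear maps out
of `F x ⟶ v` with families of linear maps out of the spaces `x ⟶ y`, for `y` over `v`. -/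
theorem bijective_restrict (hF : IsGaloisCovering k G F) {u v : B} (x : C) (hx : F.obj x = u)
    {N : Type u} [AddCommGroup N] [Module k N] :
    (∀ ψ : ∀ y (_ : F.obj y = v), (x ⟶ y) →ₗ[k] N, ∃ φ : (u ⟶ v) →ₗ[k] N,
      ∀ y (hy : F.obj y = v) (c : x ⟶ y), φ (mapHom k F hx hy c) = ψ y hy c) ∧
    ∀ φ φ' : (u ⟶ v) →ₗ[k] N, (∀ y (hy : F.obj y = v) (c : x ⟶ y),
      φ (mapHom k F hx hy c) = φ' (mapHom k F hx hy c)) → φ = φ' := by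
  subst hx
  obtain ⟨E, hadd, hlin, hfull, hfaith, hE, hEF⟩ := hF
  subst hEF
  obtain ⟨v, rfl⟩ := hE.2 v
  let e : OrbitCategory.Hom (OrbitCategory.mk k G x) v ≃ₗ[k]
      (E.obj (OrbitCategory.mk k G x) ⟶ E.obj v) :=
    LinearEquiv.ofBijective
      (E.mapLinearMap k : (OrbitCategory.mk k G x ⟶ v) →ₗ[k] _)
      ⟨E.map_injective, E.map_surjective⟩
  have he : ∀ y (hy : E.obj (OrbitCategory.mk k G y) = E.obj v) (c : x ⟶ y),
      mapHom k (OrbitCategory.proj k G C ⋙ E) rfl hy c =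
        e (OrbitCategory.cls rfl (hE.1 hy) c) := by
    intro y hy c
    obtain rfl := hE.1 hy
    exact mapHom_rfl c
  constructor
  · intro ψ
    obtain ⟨φ, hφ⟩ := OrbitCategory.exists_lift_of_source (v := v) x rfl
      fun y hy => ψ y (congrArg E.obj hy)
    refine ⟨φ ∘ₗ e.symm.toLinearMap, fun y hy c => ?_⟩
    rw [he y hy c]
    exact (congrArg φ (e.symm_apply_apply _)).trans (hφ y _ c)
  · intro φ φ' h
    have : φ ∘ₗ e.toLinearMap = φ' ∘ₗ e.toLinearMap := by
      refine OrbitCategory.hom_ext_of_source x rfl fun y hy c => ?_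
      have h' := he y (congrArg E.obj hy) c
      exact (congrArg φ h').symm.trans ((h y (congrArg E.obj hy) c).trans (congrArg φ' h'))
    refine LinearMap.ext fun f => ?_
    obtain ⟨g, rfl⟩ := e.surjective f
    exact LinearMap.congr_fun this g

/-- Families of multilinear maps on the paths of `C` which start at `x₀` and lie over a given
sequence `u` of objects of `B`. -/
abbrev PathFamily (k : Type u) [Field k] [Linear k C] (F : C ⥤ B) {n : ℕ} (u : Fin (n + 1) → B)
    (x₀ : C) (N : Type u) [AddCommGroup N] [Module k N] : Type u :=
  ∀ x : {x : Fin (n + 1) → C // (∀ i, F.obj (x i) = u i) ∧ x 0 = x₀},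
    MultilinearMap k (fun j : Fin n => (x.1 j.castSucc ⟶ x.1 j.succ)) N

/-- The restriction of a multilinear map on the paths of `B` to the paths of `C`. -/
def restrictPaths {n : ℕ} (u : Fin (n + 1) → B) (x₀ : C) (N : Type u) [AddCommGroup N]
    [Module k N] :
    MultilinearMap k (fun j : Fin n => (u j.castSucc ⟶ u j.succ)) N →ₗ[k]
      PathFamily k F u x₀ N where
  toFun f x := f.compLinearMap fun _ => mapHom k F (x.2.1 _) (x.2.1 _)
  map_add' _ _ := rfl
  map_smul' _ _ := rfl

theorem restrictPaths_cons {n : ℕ} (u : Fin (n + 2) → B) {x₀ : C} (hx₀ : F.obj x₀ = u 0)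
    {N : Type u} [AddCommGroup N] [Module k N] (x : Fin (n + 1) → C) (hx : ∀ i, F.obj (x i) = u i.succ)
    (hcons : ∀ i, F.obj ((Fin.cons x₀ x : Fin (n + 2) → C) i) = u i) (c : x₀ ⟶ x 0)
    (c' : ∀ j : Fin n, x j.castSucc ⟶ x j.succ)
    (f : MultilinearMap k (fun j : Fin (n + 1) => (u j.castSucc ⟶ u j.succ)) N) :
    restrictPaths (F := F) u x₀ N f ⟨Fin.cons x₀ x, hcons, rfl⟩ (Fin.cons c c') =
      restrictPaths (F := F) (fun i => u i.succ) (x 0) N (f.curryLeft (mapHom k F hx₀ (hx 0) c))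
        ⟨x, hx, rfl⟩ c' :=
  congrArg f (funext (Fin.cases rfl fun _ => rfl))

/-- A multilinear map on the paths of `B` is determined by its restriction to the paths of `C`, by
currying and induction on the length. -/
theorem injective_restrictPaths (hF : IsGaloisCovering k G F) {n : ℕ} (u : Fin (n + 1) → B)
    (x₀ : C) (hx₀ : F.obj x₀ = u 0) (N : Type u) [AddCommGroup N] [Module k N] :
    Function.Injective (restrictPaths (k := k) (F := F) u x₀ N) := by
  induction n generalizing x₀ with
  | zero =>
    intro f f' h
    ext c
    have := DFunLike.congr_fun (congrFun h ⟨fun _ => x₀, fun i => by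
      rw [hx₀, Fin.fin_one_eq_zero i], rfl⟩) default
    refine Eq.trans ?_ (this.trans ?_)
    · exact congrArg f (Subsingleton.elim _ _)
    · exact congrArg f' (Subsingleton.elim _ _)
  | succ n ih =>
    intro f f' h
    have hcurry : f.curryLeft = f'.curryLeft := by
      refine (hF.bijective_restrict x₀ hx₀).2 _ _ fun y hy c => ?_
      refine ih (fun i => u i.succ) y hy (funext fun x => MultilinearMap.ext fun c' => ?_)
      obtain ⟨x, hx, rfl⟩ := x
      have hcons : ∀ i, F.obj ((Fin.cons x₀ x : Fin (n + 2) → C) i) = u i := Fin.cases hx₀ hx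
      exact (restrictPaths_cons u hx₀ x hx hcons c c' f).symm.trans
        ((DFunLike.congr_fun (congrFun h ⟨Fin.cons x₀ x, hcons, rfl⟩) (Fin.cons c c')).trans
          (restrictPaths_cons u hx₀ x hx hcons c c' f'))
    rw [← MultilinearMap.uncurry_curryLeft f, hcurry, MultilinearMap.uncurry_curryLeft]

/-- Every family of multilinear maps on the paths of `C` which start at `x₀` is the restriction of a
multilinear map on the paths of `B`: the family is curried at the first morphism `x₀ ⟶ y`, and the
paths which start at `y` are treated by induction. -/
theorem surjective_restrictPaths (hF : IsGaloisCovering k G F) {n : ℕ} (u : Fin (n + 1) → B)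
    (x₀ : C) (hx₀ : F.obj x₀ = u 0) (N : Type u) [AddCommGroup N] [Module k N] :
    Function.Surjective (restrictPaths (k := k) (F := F) u x₀ N) := by
  induction n generalizing x₀ with
  | zero =>
    intro h
    refine ⟨MultilinearMap.constOfIsEmpty k _ (h ⟨fun _ => x₀, fun i => by
      rw [hx₀, Fin.fin_one_eq_zero i], rfl⟩ default), ?_⟩
    funext ⟨x, hx, hx0⟩
    obtain rfl : x = fun _ => x₀ := funext fun i => by rw [Fin.fin_one_eq_zero i, hx0]
    ext c
    exact congrArg (h _) (Subsingleton.elim _ _)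
  | succ n ih =>
    intro h
    have ih' : ∀ y (hy : F.obj y = u (Fin.succ 0)), Function.Bijective
        (restrictPaths (k := k) (F := F) (fun i => u i.succ) y N) := fun y hy =>
      ⟨hF.injective_restrictPaths _ y hy N, ih _ y hy⟩
    have hcons : ∀ x : Fin (n + 1) → C, (∀ i, F.obj (x i) = u i.succ) →
        ∀ i, F.obj ((Fin.cons x₀ x : Fin (n + 2) → C) i) = u i :=
      fun x hx => Fin.cases hx₀ hx
    -- for `y` over `u 1`, a morphism `x₀ ⟶ y` determines a family on the paths which start at `y`
    let ψ : ∀ y (hy : F.obj y = u (Fin.succ 0)), (x₀ ⟶ y) →ₗ[k]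
        PathFamily k F (fun i => u i.succ) y N := fun y hy =>
      LinearMap.pi fun x =>
        ((h ⟨Fin.cons x₀ x.1, hcons x.1 x.2.1, rfl⟩).curryLeft :
          (x₀ ⟶ x.1 0) →ₗ[k] MultilinearMap k
            (fun j : Fin n => (x.1 j.castSucc ⟶ x.1 j.succ)) N) ∘ₗ
          Linear.rightComp k x₀ (eqToHom x.2.2.symm)
    obtain ⟨φ, hφ⟩ := (hF.bijective_restrict x₀ hx₀).1 fun y hy =>
      (LinearEquiv.ofBijective _ (ih' y hy)).symm.toLinearMap ∘ₗ ψ y hy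
    obtain ⟨f, hf⟩ : ∃ f : MultilinearMap k (fun j : Fin (n + 1) => (u j.castSucc ⟶ u j.succ)) N,
        ∀ z, f.curryLeft z = φ z := by
      refine ⟨LinearMap.uncurryLeft (M := fun j : Fin (n + 1) => (u j.castSucc ⟶ u j.succ)) φ,
        fun z => MultilinearMap.ext fun m => ?_⟩
      rfl
    refine ⟨f, ?_⟩
    funext ⟨x, hx, hx0⟩
    obtain ⟨a, x, rfl⟩ : ∃ a x', x = Fin.cons a x' := ⟨x 0, Fin.tail x, (Fin.cons_self_tail x).symm⟩
    obtain rfl : a = x₀ := hx0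
    ext c
    obtain ⟨c₀, c, rfl⟩ : ∃ (c₀ : a ⟶ x 0) (c' : ∀ j : Fin n, x j.castSucc ⟶ x j.succ),
      c = Fin.cons c₀ c' := ⟨c 0, fun j => c j.succ, (Fin.cons_self_tail c).symm⟩
    refine (restrictPaths_cons u hx₀ x (fun i => hx i.succ) hx c₀ c _).trans ?_
    replace hf := (hf (mapHom k F hx₀ (hx 1) c₀)).trans (hφ (x 0) (hx 1) c₀)
    refine (congrArg (fun f => restrictPaths (fun i => u i.succ) (x 0) N f
      ⟨x, fun i => hx i.succ, rfl⟩ c) hf).trans ?_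
    have hψ := congrFun ((LinearEquiv.ofBijective _ (ih' (x 0) (hx 1))).apply_symm_apply
      (ψ (x 0) (hx 1) c₀)) ⟨x, fun i => hx i.succ, rfl⟩
    refine (congrArg (fun g => g c) hψ).trans ?_
    exact congrArg (fun d : a ⟶ x 0 => h ⟨Fin.cons a x, hx, rfl⟩ (Fin.cons d c))
      (Category.comp_id c₀)

end IsGaloisCovering

/-! ### The cochains of the base are the invariant cochains of the covering -/

namespace HochschildMitchell

open LinearGroupAction IsGaloisCovering

variable {k G C B : Type u} [Field k] [Group G] [SmallCategory C]
    [Preadditive C] [Linear k C] [MulAction G C] [LinearGroupAction k G C] [FreeOnObjects G C]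
    [SmallCategory B] [Preadditive B] [Linear k B] (F : C ⥤ B) [F.Additive] [F.Linear k]

theorem seg_map {n : ℕ} (x : Fin (n + 1) → C) (c : ∀ j : Fin n, x j.castSucc ⟶ x j.succ)
    {p q : Fin (n + 1)} (h : p ≤ q) :
    seg (fun i => F.obj (x i)) (fun j => F.map (c j)) h = F.map (seg x c h) := by
  refine seg_induction (P := fun p q h => seg (fun i => F.obj (x i)) (fun j => F.map (c j)) h =
    F.map (seg x c h)) ?_ ?_ h
  · intro p
    rw [seg_refl, seg_refl, F.map_id]
  · intro p j h ih
    rw [seg_trans _ _ h (Fin.castSucc_lt_succ (i := j)).le, seg_succ, ih,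
      seg_trans x c h (Fin.castSucc_lt_succ (i := j)).le, F.map_comp, seg_succ]

/-- The restriction of a cochain along a functor. -/
def restrictCochain (M : CatBimodule k B) (n : ℕ) : Cochain M n →ₗ[k] Cochain (M.lift F) n where
  toFun f x := (f fun i => F.obj (x i)).compLinearMap fun _ => F.mapLinearMap k
  map_add' _ _ := rfl
  map_smul' _ _ := rfl

theorem restrictCochain_apply (M : CatBimodule k B) (n : ℕ) (f : Cochain M n) (x : Fin (n + 1) → C)
    (c : ∀ j : Fin n, x j.castSucc ⟶ x j.succ) :
    restrictCochain F M n f x c = f (fun i => F.obj (x i)) fun j => F.map (c j) := rfl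

theorem restrictCochain_coface (M : CatBimodule k B) {m n : ℕ} (θ : Fin (m + 1) →o Fin (n + 1)) :
    restrictCochain F M n ∘ₗ coface M θ = coface (M.lift F) θ ∘ₗ restrictCochain F M m := by
  refine LinearMap.ext fun f => funext fun x => MultilinearMap.ext fun c => ?_
  rw [LinearMap.comp_apply, LinearMap.comp_apply, restrictCochain_apply, coface_apply, coface_apply,
    restrictCochain_apply, seg_map, seg_map]
  have hp : pull θ (fun i => F.obj (x i)) (fun j => F.map (c j)) =
      fun j => F.map (pull θ x c j) := funext fun j => seg_map F x c _
  rw [hp]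
  rfl

/-- The restriction of cochains along a functor, as a map of complexes. -/
def restrictComplex (M : CatBimodule k B) : cochainComplex M ⟶ cochainComplex (M.lift F) :=
  (AlgebraicTopology.alternatingCofaceMapComplex (ModuleCat.{u} k)).map
    { app := fun n => ModuleCat.ofHom (restrictCochain F M n.len)
      naturality := fun _ _ θ =>
        ModuleCat.hom_ext (restrictCochain_coface F M θ.toOrderHom) }

variable {F}

theorem restrictCochain_injective (hF : IsGaloisCovering k G F) (M : CatBimodule k B) (n : ℕ) :
    Function.Injective (restrictCochain F M n) := by
  intro f f' h
  funext u
  obtain ⟨x₀, hx₀⟩ := hF.surjective_obj (u 0)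
  refine hF.injective_restrictPaths u x₀ hx₀ _
    (funext fun ⟨x, hx, h0⟩ => MultilinearMap.ext fun c => ?_)
  obtain rfl : (fun i => F.obj (x i)) = u := funext hx
  have h' := DFunLike.congr_fun (congrFun h x) c
  have hmap : (fun j => mapHom k F (hx j.castSucc) (hx j.succ) (c j)) = fun j => F.map (c j) :=
    funext fun j => mapHom_rfl (c j)
  have key : ∀ f : Cochain M n, restrictPaths (F := F) (fun i => F.obj (x i)) x₀ _
      (f fun i => F.obj (x i)) ⟨x, hx, h0⟩ c = f (fun i => F.obj (x i)) fun j => F.map (c j) :=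
    fun f => congrArg (f _) hmap
  exact (key f).trans (h'.trans (key f').symm)

/-- The restriction of a cochain of the base is invariant under the group. -/
theorem galoisCochain_restrictCochain (hF : IsGaloisCovering k G F) (M : CatBimodule k B) (s : G)
    (n : ℕ) (f : Cochain M n) :
    galoisCochain hF M s n (restrictCochain F M n f) = restrictCochain F M n f := by
  funext x
  ext c
  rw [galoisCochain_apply, restrictCochain_apply, restrictCochain_apply]
  refine (cochain_cast M f (fun i => F.obj (s⁻¹ • x i)) (fun i => F.obj (x i))
    (fun i => hF.obj_smul s⁻¹ (x i)) _).trans (congrArg (f _) (funext fun j => ?_))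
  rw [hF.map_hom]
  simp

/-- A cochain of the covering which is invariant under the group comes from the base: its values on
the paths starting at a chosen object over `u 0` determine a multilinear map on the paths of the
base through `u`, and every path of the covering can be translated to such a path. -/
theorem exists_restrictCochain_eq (hF : IsGaloisCovering k G F) (M : CatBimodule k B)
    (n : ℕ) (y : Cochain (M.lift F) n) (hy : ∀ s, galoisCochain hF M s n y = y) :
    ∃ f, restrictCochain F M n f = y := by
  choose r hr using hF.surjective_obj
  have hf : ∀ u : Fin (n + 1) → B, ∃ f : MultilinearMap k
      (fun j : Fin n => (u j.castSucc ⟶ u j.succ)) (M.obj (u (Fin.last n)) (u 0)),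
      ∀ (x : Fin (n + 1) → C) (hx : ∀ i, F.obj (x i) = u i) (_ : x 0 = r (u 0))
        (c : ∀ j : Fin n, x j.castSucc ⟶ x j.succ),
        f (fun j => mapHom k F (hx _) (hx _) (c j)) = M.cast (hx _) (hx _) (y x c) := by
    intro u
    obtain ⟨f, hf⟩ := hF.surjective_restrictPaths u (r (u 0)) (hr _)
      (M.obj (u (Fin.last n)) (u 0)) fun x =>
        (M.cast (x.2.1 _) (x.2.1 _)).compMultilinearMap (y x.1)
    exact ⟨f, fun x hx h0 c => DFunLike.congr_fun (congrFun hf ⟨x, hx, h0⟩) c⟩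
  choose f hf using hf
  refine ⟨f, funext fun x => MultilinearMap.ext fun c => ?_⟩
  -- `s` translates `x 0` to the chosen object over its image
  obtain ⟨s, hs⟩ := hF.exists_smul_eq (hr (F.obj (x 0)))
  obtain ⟨s, rfl⟩ : ∃ t, s = t⁻¹ := ⟨s⁻¹, (inv_inv s).symm⟩
  rw [restrictCochain_apply]
  have h1 := hf (fun i => F.obj (x i)) (fun i => s⁻¹ • x i)
    (fun i => hF.obj_smul s⁻¹ (x i)) hs fun j => hom (k := k) s⁻¹ (c j)
  have h2 : (fun j => mapHom k F (hF.obj_smul s⁻¹ _) (hF.obj_smul s⁻¹ _) (hom (k := k) s⁻¹ (c j))) =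
      fun j : Fin n => F.map (c j) := by
    funext j
    rw [mapHom_apply, hF.map_hom]
    simp
  rw [h2] at h1
  refine h1.trans ?_
  exact DFunLike.congr_fun (congrFun (hy s) x) c

/-- The complex of cochains of the covering with the action of the group. -/
def galoisComplex (hF : IsGaloisCovering k G F) (M : CatBimodule k B) : EquivariantComplex k G where
  K := cochainComplex (M.lift F)
  act := galoisComplexMap hF M
  act_one := galoisComplexMap_one hF M
  act_mul := galoisComplexMap_mul hF M

/-- A free `G`-set has an equivariant map to `G`. -/
theorem exists_equivariant_map (G C : Type u) [Group G] [MulAction G C] [FreeOnObjects G C] :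
    ∃ τ : C → G, ∀ (s : G) x, τ (s • x) = s * τ x := by
  let r : C → C := fun x => (Quotient.mk (MulAction.orbitRel G C) x).out
  have hr : ∀ (s : G) x, r (s • x) = r x := fun s x =>
    congrArg Quotient.out (Quotient.sound (s := MulAction.orbitRel G C) ⟨s, rfl⟩)
  have hex : ∀ x, ∃ s : G, s • r x = x := fun x =>
    (MulAction.orbitRel G C).symm (Quotient.mk_out (s := MulAction.orbitRel G C) x)
  choose τ hτ using hex
  refine ⟨τ, fun s x => ?_⟩
  have := FreeOnObjects.eq_one_of_smul_eq ((s * τ x)⁻¹ * τ (s • x)) (r x) (by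
    rw [mul_smul, inv_smul_eq_iff, mul_smul, hτ, ← hr s x, hτ])
  exact (inv_mul_eq_one.1 this).symm

/-- The cochains of the covering have no group cohomology in positive degrees, since they form a
product over the free `G`-set of the sequences of objects. -/
theorem galoisComplex_acyclic (hF : IsGaloisCovering k G F) (M : CatBimodule k B) (p q : ℕ)
    (φ : (Fin (p + 1) → G) → (galoisComplex hF M).rep q)
    (hφ : (inhomogeneousCochains.d ((galoisComplex hF M).rep q) (p + 1)).hom φ = 0) :
    ∃ ψ, (inhomogeneousCochains.d ((galoisComplex hF M).rep q) p).hom ψ = φ := by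
  obtain ⟨τ, hτ⟩ := exists_equivariant_map G C
  let Δ : (C → Cochain (M.lift F) q) →ₗ[k] Cochain (M.lift F) q :=
    { toFun := fun a x => a (x 0) x
      map_add' := fun _ _ => rfl
      map_smul' := fun _ _ => rfl }
  exact groupCohomology.exists_d_eq_of_diagonal ((galoisComplex hF M).rep q) τ hτ Δ
    (fun s a => rfl) (fun v => rfl) p φ hφ

end HochschildMitchell

end

theorem mainTheorem2 {k G C B : Type u} [Field k] [Group G]
    [SmallCategory C] [Preadditive C] [Linear k C]
    [SmallCategory B] [Preadditive B] [Linear k B]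
    [MulAction G C] [LinearGroupAction k G C] [FreeOnObjects G C]
    (F : C ⥤ B) [F.Additive] [F.Linear k] (hF : IsGaloisCovering k G F)
    (M : CatBimodule k B) (hM : M.LocallyFinite) :
    ∃ E : E₂CohomologicalSpectralSequenceNat (ModuleCat.{u} k),
      (∀ p q : ℕ, Nonempty
        ((E.page 2 le_rfl).X (p, q) ≅ groupCohomology (HochschildMitchell.galoisRep hF M q) p)) ∧
      E.ConvergesTo (fun n => HochschildMitchell.cohomology M n) := by
  exact (HochschildMitchell.galoisComplex hF M).exists_spectralSequence
    (HochschildMitchell.cochainComplex M) (HochschildMitchell.restrictComplex F M)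
    (HochschildMitchell.restrictCochain_injective hF M)
    (fun n y => ⟨fun h => HochschildMitchell.exists_restrictCochain_eq hF M n y h, by
      rintro ⟨f, rfl⟩ s
      exact HochschildMitchell.galoisCochain_restrictCochain hF M s n f⟩)
    (HochschildMitchell.galoisComplex_acyclic hF M)
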